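/- Let $G$ be a finite group. A \emph{$G$-lattice} is a $\mathbb Z G$-module $L$ which is free abelian of finite rank. A class $\alpha\in H^2(G,L)$ is \emph{special} if its restriction to every nontrivial subgroup of $G$ is nonzero (equivalently, the corresponding extension of $G$ by $L$ is torsion-free). The \emph{Vasquez number} $n(G)$ is the smallest integer $m\ge 0$ such that for every faithful $G$-lattice $L$ and every special $\alpha\in H^2(G,L)$ there is a $\mathbb Z$-pure $G$-submodule $N\subseteq L$ with $\operatorname{rk}_{\mathbb Z}(L/N)\le m$ and with $\nu_*(\alpha)\in H^2(G,L/N)$ special, where $\nu\colon L\to L/N$ is the natural homomorphism. An \emph{aspherical Kähler group} of dimension $n$ is the fundamental group of a quotient of a compact complex $n$-torus by a free action of a finite group, that is, a group acting freely on $\mathbb C^n$ by complex affine transformations, such that the translations in it form a lattice of full rank $2n$ in $\mathbb C^n$ and a subgroup of finite index. Its \emph{holonomy group} is $\Gamma/L$, where $L$ is the maximal abelian normal subgroup of $\Gamma$. The \emph{complex Vasquez number} $n_{\mathbb C}(G)$ is the smallest integer $m\ge 0$ such that for every aspherical Kähler group $\Gamma$ (of any dimension) with holonomy group isomorphic to $G$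 and maximal abelian normal subgroup $L$, there is a subgroup $M\subseteq L$, normal in $\Gamma$, such that $\Gamma/M$ is an aspherical Kähler group of dimension at most $m$. If $G$ has odd order, then both numbers exist (there are integers $m$ with the respective properties) and $$n_{\mathbb C}(G)=\left\lfloor \frac{n(G)+1}{2}\right\rfloor .$$ -/

import Mathlib

open CategoryTheory

noncomputable section

/-! ### Special cohomology classes and the Vasquez number -/

/-- The restriction map `H²(G, A) → H²(H, A)` to a subgroup `H` of `G`. -/
def resH2 {G : Type} [Group G] (A : Rep.{0} ℤ G) (H : Subgroup G) :
    groupCohomology.H2 A ⟶ groupCohomology.H2 (Rep.res H.subtype A) :=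
  groupCohomology.map H.subtype (𝟙 (Rep.res H.subtype A)) 2

/-- A class `α ∈ H²(G, A)` is special if its restriction to every nontrivial subgroup of `G` is
nonzero; equivalently, the extension of `G` by the lattice `A` given by `α` is torsion-free. -/
def IsSpecial {G : Type} [Group G] (A : Rep.{0} ℤ G) (α : groupCohomology.H2 A) : Prop :=
  ∀ H : Subgroup G, H ≠ ⊥ → (resH2 A H).hom α ≠ 0

/-- `N` is a `ℤ`-pure submodule of `L`: `N ∩ k L = k N` for every integer `k`. -/
def IsZPure {L : Type} [AddCommGroup L] (N : Submodule ℤ L) : Prop :=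
  ∀ (k : ℤ) (x : L), k • x ∈ N → ∃ y ∈ N, k • x = k • y

/-- The natural homomorphism `ν : L → L / N` of `ℤ G`-modules, for a `G`-stable submodule `N`. -/
def quotientHom {G L : Type} [Group G] [AddCommGroup L] (ρ : Representation ℤ G L)
    (N : Submodule ℤ L) (hN : ∀ g : G, N ≤ N.comap (ρ g)) :
    Rep.of ρ ⟶ Rep.of (ρ.quotient N hN) :=
  Rep.ofHom ⟨N.mkQ, fun _ => rfl⟩

/-- The induced map `ν_* : H²(G, L) → H²(G, L / N)`. -/
def quotientH2 {G L : Type} [Group G] [AddCommGroup L] (ρ : Representation ℤ G L)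
    (N : Submodule ℤ L) (hN : ∀ g : G, N ≤ N.comap (ρ g)) :
    groupCohomology.H2 (Rep.of ρ) ⟶ groupCohomology.H2 (Rep.of (ρ.quotient N hN)) :=
  (groupCohomology.functor ℤ G 2).map (quotientHom ρ N hN)

/-- `m` satisfies the conclusion of Vasquez's theorem for `G`: for every faithful `G`-lattice `L`
and every special `α ∈ H²(G, L)` there is a `ℤ`-pure `G`-submodule `N` of `L` such that
`rank (L / N) ≤ m` and `ν_* α` is special. -/
def IsVasquezBound (G : Type) [Group G] (m : ℕ) : Prop :=
  ∀ (L : Type) [AddCommGroup L] [Module.Free ℤ L] [Module.Finite ℤ L]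
    (ρ : Representation ℤ G L), Function.Injective ρ →
    ∀ α : groupCohomology.H2 (Rep.of ρ), IsSpecial (Rep.of ρ) α →
      ∃ (N : Submodule ℤ L) (hN : ∀ g : G, N ≤ N.comap (ρ g)),
        IsZPure N ∧ Module.finrank ℤ (L ⧸ N) ≤ m ∧
          IsSpecial (Rep.of (ρ.quotient N hN)) ((quotientH2 ρ N hN).hom α)

/-- The Vasquez number `n(G)`. -/
def vasquezNumber (G : Type) [Group G] : ℕ := sInf {m | IsVasquezBound G m}

/-! ### Aspherical Kähler groups and the complex Vasquez number -/

/-- The vectors of all translations in the image of `ρ : Γ → Aff(ℂⁿ)`. -/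
def translationVectors {n : ℕ} {Γ : Type} [Group Γ]
    (ρ : Γ →* (EuclideanSpace ℂ (Fin n) ≃ᵃ[ℂ] EuclideanSpace ℂ (Fin n))) :
    AddSubgroup (EuclideanSpace ℂ (Fin n)) where
  carrier := {v | ∃ γ : Γ, ∀ x, ρ γ x = v + x}
  zero_mem' := ⟨1, fun x => by simp⟩
  add_mem' := by
    rintro v w ⟨γ, hγ⟩ ⟨δ, hδ⟩
    exact ⟨γ * δ, fun x => by rw [map_mul, AffineEquiv.mul_def, AffineEquiv.trans_apply, hδ, hγ,
      add_assoc]⟩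
  neg_mem' := by
    rintro v ⟨γ, hγ⟩
    refine ⟨γ⁻¹, fun x => ?_⟩
    rw [map_inv, AffineEquiv.inv_def, AffineEquiv.symm_apply_eq, hγ, add_neg_cancel_left]

/-- `Γ` is an aspherical Kähler group of (complex) dimension `n`, that is, the fundamental group of
a quotient of a compact complex `n`-torus by a free action of a finite group. Such a group is the
group of all lifts to the universal cover `ℂⁿ` of the elements of the finite group: it acts
freely on `ℂⁿ` by complex affine maps, its translations form a lattice in `ℂⁿ` and
have finite index, i.e. the linear parts form a finite group. -/
def IsAsphericalKahlerGroup (n : ℕ) (Γ : Type) [Group Γ] : Prop :=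
  ∃ ρ : Γ →* (EuclideanSpace ℂ (Fin n) ≃ᵃ[ℂ] EuclideanSpace ℂ (Fin n)),
    (∀ γ : Γ, γ ≠ 1 → ∀ x, ρ γ x ≠ x) ∧
    DiscreteTopology (translationVectors ρ) ∧
    Submodule.span ℝ (translationVectors ρ : Set (EuclideanSpace ℂ (Fin n))) = ⊤ ∧
    Finite (AffineEquiv.linearHom.comp ρ).range

/-- `L` is a maximal abelian normal subgroup of `Γ`. -/
def IsMaximalAbelianNormal {Γ : Type} [Group Γ] (L : Subgroup Γ) : Prop :=
  Maximal (fun A : Subgroup Γ => A.Normal ∧ ∀ a ∈ A, ∀ b ∈ A, a * b = b * a) L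

/-- `m` satisfies the conclusion of the complex Vasquez theorem for `G`: for every aspherical Kähler
group `Γ` with holonomy group `G` (i.e. `Γ / L ≅ G` for the maximal abelian normal subgroup `L`)
there is a subgroup `M ≤ L`, normal in `Γ`, such that `Γ / M` is an aspherical Kähler group of
dimension at most `m`. -/
def IsComplexVasquezBound (G : Type) [Group G] (m : ℕ) : Prop :=
  ∀ (Γ : Type) [Group Γ] (n : ℕ), IsAsphericalKahlerGroup n Γ →
    ∀ (L : Subgroup Γ) [L.Normal], IsMaximalAbelianNormal L → Nonempty (Γ ⧸ L ≃* G) →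
      ∃ (M : Subgroup Γ) (_ : M.Normal), M ≤ L ∧
        ∃ d : ℕ, d ≤ m ∧ IsAsphericalKahlerGroup d (Γ ⧸ M)

/-- The complex Vasquez number `n_ℂ(G)`. -/
def complexVasquezNumber (G : Type) [Group G] : ℕ := sInf {m | IsComplexVasquezBound G m}

end

/-! Write `n` and `c` for the real and complex numbers. The theorem amounts to `c ≤ ⌊(n + 1) / 2⌋`
and `n ≤ 2 * c`. Throughout, classes in `H²` are traded for group extensions: a class is special
exactly when its extension is torsion-free (`isSpecial_iff_torsionFree`), and pushing it to `L / N`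
amounts to dividing the extension by `N`.

That some real bound exists is Vasquez's theorem. For every `g` of prime order `p`, torsion-freeness
gives an integral functional whose value on the `p`-th power of each lift of `g` is prime to `p`
(`exists_detecting_functional`). The common kernel of all `G`-translates of these functionals can be
divided out without creating torsion.

For `c ≤ ⌊(n + 1) / 2⌋`, the lattice of a Kähler group has even rank, and its translations form the
maximal abelian normal subgroup. A Vasquez quotient `L / N` of odd rank can be enlarged by one,
since `N` then has odd rank and carries a nonzero invariant functional (`exists_even_quotient`). In
odd order, every real representation of even dimension has an invariant complex structure
(`hasComplexStructure_of_even`), as its part without invariants always has one. So the torsion-free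
quotient acts on a complex vector space as a Kähler group.

For `n ≤ 2 * c`, which needs no parity, double the lattice: `L ⊕ L` has the complex structure `(x,
y) ↦ (-y, x)`, and `(α, 0)` is special. A Kähler quotient of the resulting group, pulled back to the
first summand, gives a quotient of `L` of rank at most `2 * c`. -/

/-! ### Extensions and special classes -/

/-- `E` is an extension of `G` by the `G`-module `A`. -/
structure IsExtension {G A E : Type} [Group G] [AddCommGroup A] [Group E]
    (ρ : Representation ℤ G A) (ι : A → E) (π : E →* G) : Prop where
  protected map_add : ∀ a b, ι (a + b) = ι a * ι b
  protected injective : Function.Injective ι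
  protected surjective : Function.Surjective π
  exact : ∀ e, π e = 1 ↔ ∃ a, ι a = e
  conj : ∀ e a, ι (ρ (π e) a) = e * ι a * e⁻¹

/-- `f` is the factor set of some section of the extension `(ι, π)`. -/
def IsFactorSet {G A E : Type} [Group G] [Group E]
    (ι : A → E) (π : E →* G) (f : G × G → A) : Prop :=
  ∃ s : G → E, (∀ g, π (s g) = g) ∧ ∀ g h, ι (f (g, h)) * s (g * h) = s g * s h

/-- The only element of finite order is the identity. -/
def TorsionFree (E : Type) [Group E] : Prop := ∀ e : E, IsOfFinOrder e → e = 1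

namespace IsExtension

variable {G A E : Type} [Group G] [AddCommGroup A] [Group E]
  {ρ : Representation ℤ G A} {ι : A → E} {π : E →* G}

protected theorem map_zero (h : IsExtension ρ ι π) : ι 0 = 1 := by
  have := h.map_add 0 0
  simpa using this

protected theorem map_neg (h : IsExtension ρ ι π) (a : A) : ι (-a) = (ι a)⁻¹ := by
  rw [eq_inv_iff_mul_eq_one, ← h.map_add, neg_add_cancel, h.map_zero]

protected theorem map_sub (h : IsExtension ρ ι π) (a b : A) : ι (a - b) = ι a * (ι b)⁻¹ := by
  rw [sub_eq_add_neg, h.map_add, h.map_neg]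

theorem proj (h : IsExtension ρ ι π) (a : A) : π (ι a) = 1 := (h.exact _).2 ⟨a, rfl⟩

protected theorem map_nsmul (h : IsExtension ρ ι π) (k : ℕ) (a : A) : ι (k • a) = ι a ^ k := by
  induction k with
  | zero => simp [h.map_zero]
  | succ k ih => rw [succ_nsmul, h.map_add, ih, pow_succ]

theorem comm (h : IsExtension ρ ι π) (a b : A) : ι a * ι b = ι b * ι a := by
  rw [← h.map_add, add_comm, h.map_add]

theorem mul_ι (h : IsExtension ρ ι π) (e : E) (a : A) : e * ι a = ι (ρ (π e) a) * e := by
  rw [h.conj]; group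

theorem exists_cocycle (h : IsExtension ρ ι π) :
    ∃ f : groupCohomology.cocycles₂ (Rep.of ρ), IsFactorSet ι π f := by
  choose s hs using h.surjective
  have hf : ∀ p : G × G, ∃ a, ι a = s p.1 * s p.2 * (s (p.1 * p.2))⁻¹ := fun p => by
    rw [← h.exact]; simp [hs]
  choose f hf using hf
  refine ⟨⟨f, ?_⟩, s, hs, fun g k => ?_⟩
  · rw [groupCohomology.mem_cocycles₂_iff]
    intro g k j
    apply h.injective
    have e1 : ι (ρ g (f (k, j))) = s g * ι (f (k, j)) * (s g)⁻¹ := by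
      rw [← h.conj, hs]
    change ι (f (g * k, j) + f (g, k)) = ι (ρ g (f (k, j)) + f (g, k * j))
    rw [add_comm, h.map_add, h.map_add, e1, hf, hf, hf, hf]
    simp only [mul_assoc]
    group
  · change ι (f (g, k)) * _ = _
    rw [hf]; group

end IsExtension

/-- The set underlying the extension given by a factor set. -/
@[ext]
structure TwistedProduct {G A : Type} (f : G × G → A) where
  /-- The component in the module. -/
  fst : A
  /-- The component in the group. -/
  snd : G

section TwistedProduct

variable {G A : Type} [Group G] [AddCommGroup A] {ρ : Representation ℤ G A}

/-- The group law on the twisted product given by a cocycle. -/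
@[reducible] def twistedGroup (f : groupCohomology.cocycles₂ (Rep.of ρ)) :
    Group (TwistedProduct (f : G × G → A)) :=
  letI F : G × G → A := f
  letI : Mul (TwistedProduct F) :=
    ⟨fun x y => ⟨x.fst + ρ x.snd y.fst + F (x.snd, y.snd), x.snd * y.snd⟩⟩
  -- The cocycle is not normalised, hence the correction by `F (1, 1)` in the identity, in the
  -- inverse and later in the embedding of `A`.
  letI : One (TwistedProduct F) := ⟨⟨-F (1, 1), 1⟩⟩
  letI : Inv (TwistedProduct F) :=
    ⟨fun x => ⟨-F (1, 1) - F (x.snd⁻¹, x.snd) - ρ x.snd⁻¹ x.fst, x.snd⁻¹⟩⟩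
  Group.ofLeftAxioms
    (fun x y z => by
      have := (groupCohomology.mem_cocycles₂_iff _).1 f.2 x.snd y.snd z.snd
      change F (x.snd * y.snd, z.snd) + F (x.snd, y.snd) =
        ρ x.snd (F (y.snd, z.snd)) + F (x.snd, y.snd * z.snd) at this
      apply TwistedProduct.ext
      · change x.fst + ρ x.snd y.fst + F (x.snd, y.snd) + ρ (x.snd * y.snd) z.fst +
          F (x.snd * y.snd, z.snd) = x.fst + ρ x.snd (y.fst + ρ y.snd z.fst + F (y.snd, z.snd)) +
          F (x.snd, y.snd * z.snd)
        simp only [map_mul, map_add, Module.End.mul_apply]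
        calc _ = x.fst + ρ x.snd y.fst + ρ x.snd (ρ y.snd z.fst) +
              (F (x.snd * y.snd, z.snd) + F (x.snd, y.snd)) := by abel
          _ = _ := by rw [this]; abel
      · exact mul_assoc _ _ _)
    (fun x => by
      have : F (1, x.snd) = F (1, 1) := groupCohomology.cocycles₂_map_one_fst f x.snd
      apply TwistedProduct.ext
      · change -F (1, 1) + ρ 1 x.fst + F (1, x.snd) = x.fst
        rw [this]; simp
      · exact one_mul _)
    (fun x => by
      apply TwistedProduct.ext
      · change -F (1, 1) - F (x.snd⁻¹, x.snd) - ρ x.snd⁻¹ x.fst + ρ x.snd⁻¹ x.fst +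
          F (x.snd⁻¹, x.snd) = -F (1, 1)
        abel
      · exact inv_mul_cancel _)

theorem exists_extension (f : groupCohomology.cocycles₂ (Rep.of ρ)) :
    ∃ (E : Type) (_ : Group E) (ι : A → E) (π : E →* G),
      IsExtension ρ ι π ∧ IsFactorSet ι π f := by
  let _ := twistedGroup f
  let F : G × G → A := f
  have hmul : ∀ x y : TwistedProduct F,
    x * y = ⟨x.fst + ρ x.snd y.fst + F (x.snd, y.snd), x.snd * y.snd⟩ := fun x y => rfl
  have h1 : ∀ g, F (1, g) = F (1, 1) := groupCohomology.cocycles₂_map_one_fst f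
  have h2 : ∀ g, F (g, 1) = ρ g (F (1, 1)) := groupCohomology.cocycles₂_map_one_snd f
  let π : TwistedProduct F →* G := MonoidHom.mk' TwistedProduct.snd fun x y => rfl
  refine ⟨TwistedProduct F, inferInstance, fun a => ⟨a - F (1, 1), 1⟩, π, ⟨?_, ?_, ?_, ?_, ?_⟩,
    fun g => ⟨0, g⟩, fun g => rfl, ?_⟩
  · intro a b
    rw [hmul]; ext <;> simp
    abel
  · intro a b hab
    simpa using congrArg TwistedProduct.fst hab
  · exact fun g => ⟨⟨0, g⟩, rfl⟩
  · rintro ⟨a, g⟩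
    constructor
    · rintro (rfl : g = 1)
      exact ⟨a + F (1, 1), by simp⟩
    · rintro ⟨b, hb⟩
      exact (congrArg TwistedProduct.snd hb).symm
  · rintro ⟨b, g⟩ a
    rw [eq_mul_inv_iff_mul_eq, hmul, hmul]
    change (⟨ρ g a - F (1, 1) + ρ 1 b + F (1, g), 1 * g⟩ : TwistedProduct F) =
      ⟨b + ρ g (a - F (1, 1)) + F (g, 1), g * 1⟩
    ext
    · simp only [h1 g, h2 g, map_one, Module.End.one_apply, map_sub]; abel
    · simp
  · intro g h
    rw [hmul, hmul]
    change (⟨F (g, h) - F (1, 1) + ρ 1 0 + F (1, g * h), 1 * (g * h)⟩ : TwistedProduct F) =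
      ⟨0 + ρ g 0 + F (g, h), g * h⟩
    ext
    · simp [h1 (g * h)]
    · simp

end TwistedProduct

/-! ### Special classes and torsion-free extensions -/

section Special

variable {G A E : Type} [Group G] [AddCommGroup A] [Group E] {ρ : Representation ℤ G A}

theorem isSpecial_iff (f : groupCohomology.cocycles₂ (Rep.of ρ)) :
    IsSpecial (Rep.of ρ) (groupCohomology.H2π _ f) ↔
      ∀ H : Subgroup G, H ≠ ⊥ → ¬ ∃ x : H → A, ∀ g h : H,
        ρ g (x h) - x (g * h) + x g = f (g, h) := by
  refine forall₂_congr fun H _ => not_congr ?_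
  have h1 : (resH2 (Rep.of ρ) H).hom (groupCohomology.H2π _ f) =
      groupCohomology.H2π _ (groupCohomology.mapCocycles₂ H.subtype
        (𝟙 (Rep.res H.subtype (Rep.of ρ))) f) :=
    congrArg (fun φ => φ.hom f) (groupCohomology.H2π_comp_map H.subtype
        (𝟙 (Rep.res H.subtype (Rep.of ρ))))
  rw [h1, groupCohomology.H2π_eq_zero_iff]
  constructor
  · rintro ⟨x, hx⟩
    exact ⟨x, fun g h => congrFun hx (g, h)⟩
  · rintro ⟨x, hx⟩
    exact ⟨x, funext fun p => hx p.1 p.2⟩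

/-- An equivariant map carries a trivialisation over `H` to one of the image cocycle, so specialness
is inherited backwards along `φ`. -/
theorem isSpecial_of_map {B : Type} [AddCommGroup B] {σ : Representation ℤ G B}
    (f : groupCohomology.cocycles₂ (Rep.of ρ)) (f' : groupCohomology.cocycles₂ (Rep.of σ))
    (φ : A →+ B) (hφ : ∀ g a, φ (ρ g a) = σ g (φ a)) (hf : ∀ p, f' p = φ (f p))
    (h : IsSpecial (Rep.of σ) (groupCohomology.H2π _ f')) :
    IsSpecial (Rep.of ρ) (groupCohomology.H2π _ f) := by
  rw [isSpecial_iff] at h ⊢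
  rintro H hH ⟨x, hx⟩
  refine h H hH ⟨fun g => φ (x g), fun g k => ?_⟩
  rw [hf, ← hx, map_add, map_sub, hφ]

theorem quotientH2_apply (N : Submodule ℤ A) (hN : ∀ g : G, N ≤ N.comap (ρ g))
    (f : groupCohomology.cocycles₂ (Rep.of ρ)) :
    ∃ f' : groupCohomology.cocycles₂ (Rep.of (ρ.quotient N hN)),
      (∀ p, f' p = N.mkQ (f p)) ∧
      (quotientH2 ρ N hN).hom (groupCohomology.H2π _ f) = groupCohomology.H2π _ f' := by
  refine ⟨groupCohomology.mapCocycles₂ (MonoidHom.id G) (quotientHom ρ N hN) f, fun p => rfl, ?_⟩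
  exact congrArg (fun φ => φ.hom f) (groupCohomology.H2π_comp_map (MonoidHom.id G)
    (quotientHom ρ N hN))

variable [Finite G] {ι : A → E} {π : E →* G}

/-- The restriction to `H` vanishes exactly when the extension splits over `H`. A splitting over `H
≠ ⊥` embeds a nontrivial finite group in `E`. Conversely, a finite cyclic subgroup of `E` meets the
torsion-free kernel trivially, so it is a splitting over its image in `G`. -/
theorem isSpecial_iff_torsionFree (hA : ∀ (k : ℕ) (a : A), k ≠ 0 → k • a = 0 → a = 0)
    (h : IsExtension ρ ι π) (f : groupCohomology.cocycles₂ (Rep.of ρ)) (hf : IsFactorSet ι π f) :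
    IsSpecial (Rep.of ρ) (groupCohomology.H2π _ f) ↔ TorsionFree E := by
  obtain ⟨s, hs, hsf⟩ := hf
  rw [isSpecial_iff]
  constructor
  · intro hsp e he
    by_contra hne
    obtain ⟨n, hn, hen⟩ := isOfFinOrder_iff_pow_eq_one.1 he
    have key : ∀ z : Subgroup.zpowers e, π z = 1 → z = 1 := by
      rintro ⟨z, hz⟩ hz1
      obtain ⟨a, rfl⟩ := (h.exact _).1 hz1
      obtain ⟨i, hi⟩ := Subgroup.mem_zpowers_iff.1 hz
      have : ι (n • a) = ι 0 := by
        rw [h.map_nsmul, ← hi, h.map_zero, ← zpow_natCast, ← zpow_mul, mul_comm, zpow_mul,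
          zpow_natCast, hen, one_zpow]
      have := hA n a hn.ne' (h.injective this)
      ext
      simp [this, h.map_zero]
    let q : Subgroup.zpowers e →* G := π.comp (Subgroup.subtype _)
    have hq : Function.Injective q := (injective_iff_map_eq_one q).2 key
    let w : Subgroup.zpowers e ≃* q.range := MonoidHom.ofInjective hq
    have hw : ∀ g : q.range, π (w.symm g) = g := fun g =>
      congrArg Subtype.val (w.apply_symm_apply g)
    -- The discrepancy between `s` and the multiplicative section `w.symm` is a cochain with
    -- coboundary `f`.
    have hx : ∀ g : q.range, ∃ a, ι a = s g * (w.symm g : E)⁻¹ := fun g => by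
      rw [← h.exact]; simp [hs, hw]
    choose x hx using hx
    refine hsp q.range ?_ ⟨x, fun g k => ?_⟩
    · intro hbot
      have : q ⟨e, Subgroup.mem_zpowers e⟩ ∈ q.range := ⟨_, rfl⟩
      rw [hbot, Subgroup.mem_bot] at this
      exact hne (congrArg Subtype.val (key ⟨e, Subgroup.mem_zpowers e⟩ this))
    · apply h.injective
      have e1 : ι (ρ g (x k)) = s g * ι (x k) * (s g)⁻¹ := by rw [← h.conj, hs]
      have e2 : ι (f (g, k)) = s g * s k * (s (g * k))⁻¹ := by rw [← hsf]; group
      have e3 : ι (ρ g (x k) - x (g * k) + x g) = ι (ρ g (x k)) * ι (x g) * (ι (x (g * k)))⁻¹ := by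
        rw [← h.map_add, ← h.map_sub]; congr 1; abel
      rw [e3, e1, e2, hx, hx, hx]
      simp
      group
  · rintro htf H hH ⟨x, hx⟩
    obtain ⟨g, hg1⟩ := Subgroup.ne_bot_iff_exists_ne_one.1 hH
    -- Correcting `s` by the trivialising cochain makes it multiplicative over `H`.
    let t : H →* E := MonoidHom.mk' (fun k => (ι (x k))⁻¹ * s k) fun a b => by
      have e1 : ι (ρ a (x b)) = s a * ι (x b) * (s a)⁻¹ := by rw [← h.conj, hs]
      have e2 := congrArg ι (hx a b)
      rw [sub_add_eq_add_sub, h.map_sub, h.map_add, e1] at e2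
      have e3 := hsf a b
      rw [← e2] at e3
      have e4 : (ι (x (a * b)))⁻¹ * s (a * b) =
          (s a * ι (x b) * (s a)⁻¹ * ι (x a))⁻¹ * (s a * s b) := by
        rw [← e3]; group
      change (ι (x (a * b)))⁻¹ * s (a * b) = _
      rw [e4]; group
    have := htf (t g) (t.isOfFinOrder (isOfFinOrder_of_finite g))
    apply hg1
    ext
    have h2 : π (t g) = g := by
      change π ((ι (x g))⁻¹ * s g) = g
      simp [h.proj, hs]
    rw [← h2, this, map_one, Subgroup.coe_one]

end Special

/-! ### Stable submodules of the kernel and quotient extensions -/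

namespace IsExtension

variable {G A E : Type} [Group G] [AddCommGroup A] [Group E] {ρ : Representation ℤ G A}
  {ι : A → E} {π : E →* G}

/-- The subgroup of an extension corresponding to a submodule of the kernel. -/
def sub (h : IsExtension ρ ι π) (N : Submodule ℤ A) : Subgroup E where
  carrier := ι '' N
  one_mem' := ⟨0, N.zero_mem, h.map_zero⟩
  mul_mem' := by
    rintro _ _ ⟨a, ha, rfl⟩ ⟨b, hb, rfl⟩
    exact ⟨a + b, N.add_mem ha hb, h.map_add a b⟩
  inv_mem' := by
    rintro _ ⟨a, ha, rfl⟩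
    exact ⟨-a, N.neg_mem ha, h.map_neg a⟩

theorem ι_mem_sub (h : IsExtension ρ ι π) (N : Submodule ℤ A) (a : A) :
    ι a ∈ h.sub N ↔ a ∈ N :=
  ⟨fun ⟨_, hb, hab⟩ => h.injective hab ▸ hb, fun ha => ⟨a, ha, rfl⟩⟩

theorem sub_normal (h : IsExtension ρ ι π) (N : Submodule ℤ A)
    (hN : ∀ g : G, N ≤ N.comap (ρ g)) : (h.sub N).Normal := by
  constructor
  rintro _ ⟨a, ha, rfl⟩ e
  exact ⟨ρ (π e) a, hN _ ha, h.conj e a⟩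

/-- A subgroup of the kernel which is normal in the extension comes from a stable submodule. -/
theorem exists_eq_sub (h : IsExtension ρ ι π) (M : Subgroup E) [M.Normal] (hM : M ≤ π.ker) :
    ∃ N : Submodule ℤ A, (∀ g : G, N ≤ N.comap (ρ g)) ∧ M = h.sub N := by
  let N : AddSubgroup A :=
    { carrier := {a | ι a ∈ M}
      zero_mem' := by simp [h.map_zero]
      add_mem' := fun {a b} ha hb => by
        simpa [h.map_add] using mul_mem (show ι a ∈ M from ha) hb
      neg_mem' := fun {a} ha => by simpa [h.map_neg] using ha }
  refine ⟨AddSubgroup.toIntSubmodule N, fun g a ha => ?_, ?_⟩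
  · obtain ⟨e, rfl⟩ := h.surjective g
    change ι (ρ (π e) a) ∈ M
    rw [h.conj]
    exact Subgroup.Normal.conj_mem ‹_› _ ha _
  · ext e
    constructor
    · intro he
      obtain ⟨a, rfl⟩ := (h.exact e).1 (hM he)
      exact ⟨a, he, rfl⟩
    · rintro ⟨a, ha, rfl⟩
      exact ha

/-- The clause on factor sets identifies the class of `E / N` with the pushforward of the class of
`E`. -/
theorem quotient (h : IsExtension ρ ι π) (N : Submodule ℤ A) (hN : ∀ g : G, N ≤ N.comap (ρ g))
    [(h.sub N).Normal] :
    ∃ (ι' : A ⧸ N → E ⧸ h.sub N) (π' : E ⧸ h.sub N →* G),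
      IsExtension (ρ.quotient N hN) ι' π' ∧
      ∀ f : G × G → A, IsFactorSet ι π f → IsFactorSet ι' π' (fun p => N.mkQ (f p)) := by
  have hι : ∀ a b : A, QuotientAddGroup.leftRel N.toAddSubgroup a b →
      (ι a : E ⧸ h.sub N) = ι b := fun a b hab => by
    rw [QuotientGroup.eq, ← h.map_neg, ← h.map_add, h.ι_mem_sub]
    exact QuotientAddGroup.leftRel_apply.1 hab
  let ι' : A ⧸ N → E ⧸ h.sub N := Quotient.lift (fun a => (ι a : E ⧸ h.sub N)) hι
  let π' : E ⧸ h.sub N →* G := QuotientGroup.lift _ π (by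
    rintro _ ⟨a, -, rfl⟩
    exact h.proj a)
  have hι' : ∀ a, ι' (N.mkQ a) = (ι a : E ⧸ h.sub N) := fun a => rfl
  have hπ' : ∀ e : E, π' (e : E ⧸ h.sub N) = π e := fun e => rfl
  refine ⟨ι', π', ⟨?_, ?_, ?_, ?_, ?_⟩, ?_⟩
  · intro x y
    obtain ⟨a, rfl⟩ := N.mkQ_surjective x
    obtain ⟨b, rfl⟩ := N.mkQ_surjective y
    rw [← _root_.map_add, hι', hι', hι', h.map_add, QuotientGroup.mk_mul]
  · intro x y hxy
    obtain ⟨a, rfl⟩ := N.mkQ_surjective x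
    obtain ⟨b, rfl⟩ := N.mkQ_surjective y
    rw [hι', hι', QuotientGroup.eq, ← h.map_neg, ← h.map_add, h.ι_mem_sub] at hxy
    rw [← sub_eq_zero, ← _root_.map_sub, Submodule.mkQ_apply, Submodule.Quotient.mk_eq_zero,
      ← N.neg_mem_iff]
    convert hxy using 1
    abel
  · intro g
    obtain ⟨e, he⟩ := h.surjective g
    exact ⟨e, he⟩
  · intro x
    obtain ⟨e, rfl⟩ := QuotientGroup.mk_surjective x
    rw [hπ', h.exact]
    constructor
    · rintro ⟨a, rfl⟩
      exact ⟨N.mkQ a, rfl⟩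
    · rintro ⟨y, hy⟩
      obtain ⟨b, rfl⟩ := N.mkQ_surjective y
      rw [hι', QuotientGroup.eq] at hy
      obtain ⟨c, -, hc⟩ := hy
      exact ⟨b + c, by rw [h.map_add, hc, mul_inv_cancel_left]⟩
  · intro x y
    obtain ⟨e, rfl⟩ := QuotientGroup.mk_surjective x
    obtain ⟨b, rfl⟩ := N.mkQ_surjective y
    rw [hπ']
    change ι' (N.mkQ (ρ (π e) b)) = _
    rw [hι', h.conj]
    rfl
  · rintro f ⟨s, hs, hsf⟩
    exact ⟨fun g => (s g : E ⧸ h.sub N), hs, fun g k => congrArg _ (hsf g k)⟩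

end IsExtension

/-! ### Torsion-free quotients of bounded rank -/

theorem TorsionFree.of_prime {E : Type} [Group E]
    (h : ∀ (e : E) (p : ℕ), p.Prime → e ^ p = 1 → e = 1) : TorsionFree E := by
  intro e he
  by_contra hne
  obtain ⟨p, hp, hpd⟩ := Nat.exists_prime_and_dvd (mt orderOf_eq_one_iff.1 hne)
  obtain ⟨m, hm⟩ := hpd
  have hpos : 0 < orderOf e := he.orderOf_pos
  have h1 : e ^ m = 1 := h _ p hp (by rw [← pow_mul, mul_comm, ← hm, pow_orderOf_eq_one])
  have h2 := Nat.le_of_dvd (Nat.pos_of_ne_zero fun h0 => hpos.ne' (by rw [hm, h0, mul_zero]))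
    (orderOf_dvd_of_pow_eq_one h1)
  have := hp.two_le
  nlinarith

theorem isZPure_iff {L : Type} [AddCommGroup L] [Module.Free ℤ L] (N : Submodule ℤ L) :
    IsZPure N ↔ ∀ (k : ℕ) (x : L), k ≠ 0 → k • x ∈ N → x ∈ N := by
  constructor
  · intro h k x hk hx
    obtain ⟨y, hy, hxy⟩ := h k x (by simpa using hx)
    rwa [smul_right_injective L (Int.natCast_ne_zero.2 hk) hxy]
  · intro h k x hx
    by_cases hk : k = 0
    · exact ⟨0, N.zero_mem, by simp [hk]⟩
    · refine ⟨x, h k.natAbs x (Int.natAbs_ne_zero.2 hk) ?_, rfl⟩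
      rcases Int.natAbs_eq k with h' | h'
      · rw [← natCast_zsmul, ← h']; exact hx
      · rw [← N.neg_mem_iff, ← natCast_zsmul, ← neg_smul, ← h']; exact hx

theorem Module.Free.nsmul_eq_zero {A : Type} [AddCommGroup A] [Module.Free ℤ A] (k : ℕ) (a : A)
    (hk : k ≠ 0) (h : k • a = 0) : a = 0 := by
  rw [← natCast_zsmul] at h
  exact (smul_eq_zero.1 h).resolve_left (Int.natCast_ne_zero.2 hk)

theorem IsZPure.nsmul_eq_zero {A : Type} [AddCommGroup A] [Module.Free ℤ A] {N : Submodule ℤ A}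
    (hN : IsZPure N) (k : ℕ) (a : A ⧸ N) (hk : k ≠ 0) (h : k • a = 0) : a = 0 := by
  obtain ⟨a, rfl⟩ := N.mkQ_surjective a
  rw [← map_nsmul, Submodule.mkQ_apply, Submodule.Quotient.mk_eq_zero] at h
  exact (Submodule.Quotient.mk_eq_zero N).2 ((isZPure_iff N).1 hN k a hk h)

theorem IsZPure.free_quotient {A : Type} [AddCommGroup A] [Module.Free ℤ A] [Module.Finite ℤ A]
    {N : Submodule ℤ A} (hN : IsZPure N) : Module.Free ℤ (A ⧸ N) := by
  have : Module.IsTorsionFree ℤ (A ⧸ N) := by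
    refine Module.isTorsionFree_int_iff_isAddTorsionFree.2 ?_
    refine ⟨fun k hk a b hab => ?_⟩
    rw [← sub_eq_zero]
    exact hN.nsmul_eq_zero k _ hk (by rw [smul_sub]; exact sub_eq_zero.2 hab)
  exact Module.free_of_finite_type_torsion_free'

/-- If `p` divides all coordinates of `z` in a basis, it divides `z`. The case `p = 0` is kept on
purpose: it gives a functional that does not vanish at a nonzero `z`. -/
theorem exists_dual_not_dvd {R : Type} [AddCommGroup R] [Module.Free ℤ R]
    (p : ℕ) (z : R) (hz : ¬ ∃ y : R, z = p • y) : ∃ φ : R →ₗ[ℤ] ℤ, ¬ (p : ℤ) ∣ φ z := by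
  by_contra! hall
  let b := Module.Free.chooseBasis ℤ R
  choose c hc using fun i => hall (b.coord i)
  by_cases hp : p = 0
  · exact hz ⟨0, by
      rw [smul_zero]
      exact b.ext_elem fun i => by simpa [hp] using hc i⟩
  · refine hz ⟨b.repr.symm (Finsupp.onFinset (b.repr z).support c fun i hi => ?_), ?_⟩
    · rw [Finsupp.mem_support_iff]
      have := hc i
      rw [Module.Basis.coord_apply] at this
      rw [this]
      exact mul_ne_zero (Int.natCast_ne_zero.2 hp) hi
    · refine b.ext_elem fun i => ?_
      simpa using hc i

namespace IsExtension

variable {G A E : Type} [Group G] [AddCommGroup A] [Group E] {ρ : Representation ℤ G A}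
  {ι : A → E} {π : E →* G}

protected theorem mul_pow (h : IsExtension ρ ι π) (a : A) (e : E) (k : ℕ) :
    (ι a * e) ^ k = ι ((∑ i ∈ Finset.range k, ρ (π e ^ i)) a) * e ^ k := by
  induction k with
  | zero => simp [h.map_zero]
  | succ k ih =>
    have : e ^ k * ι a = ι (ρ (π e ^ k) a) * e ^ k := by rw [h.mul_ι, map_pow]
    rw [pow_succ, ih, Finset.sum_range_succ, LinearMap.add_apply, h.map_add, pow_succ,
      mul_assoc, ← mul_assoc (e ^ k), this]
    simp only [mul_assoc]

/-- Let `T` be the norm of `g` and `ι x = t ^ p` for a lift `t`. The other lifts `ι l * t` have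
`p`-th power `ι (T l + x)`, so torsion-freeness says that `x` is not a norm. Since `x` is fixed by
`g`, `T x = p • x`, and therefore `T x` is not in `p • T A`. A functional `φ` on the lattice `T A`
with `φ (T x)` prime to `p` gives `ψ = φ ∘ T`: the contribution of `T l` is divisible by `p` because
`T (T l) = p • T l`. -/
theorem exists_detecting_functional [Module.Free ℤ A] [Module.Finite ℤ A]
    (h : IsExtension ρ ι π) (htf : TorsionFree E) (g : G) (p : ℕ) (hp : p.Prime)
    (hg : orderOf g = p) :
    ∃ ψ : A →ₗ[ℤ] ℤ, ∀ e : E, π e = g → ∀ a, ι a = e ^ p → ¬ (p : ℤ) ∣ ψ a := by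
  obtain ⟨t, ht⟩ := h.surjective g
  have hgp : g ^ p = 1 := hg ▸ pow_orderOf_eq_one g
  obtain ⟨x, hx⟩ := (h.exact (t ^ p)).1 (by rw [map_pow, ht, hgp])
  let T : A →ₗ[ℤ] A := ∑ i ∈ Finset.range p, ρ (g ^ i)
  have hT : ∀ a, T a = ∑ i ∈ Finset.range p, ρ (g ^ i) a := fun a => by simp [T]
  have hfix : ∀ y, ρ g y = y → T y = p • y := fun y hy => by
    have : ∀ i : ℕ, ρ (g ^ i) y = y := fun i => by
      induction i with
      | zero => simp
      | succ i ih => rw [pow_succ, map_mul, Module.End.mul_apply, hy, ih]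
    rw [hT, Finset.sum_congr rfl fun i _ => this i]; simp
  have hxfix : ρ g x = x := by
    apply h.injective
    rw [← ht, h.conj, hx]
    group
  have hTfix : ∀ y, ρ g (T y) = T y := fun y => by
    have h1 : ρ g (T y) = ∑ i ∈ Finset.range p, ρ (g ^ (i + 1)) y := by
      rw [hT, map_sum]
      refine Finset.sum_congr rfl fun i _ => ?_
      rw [pow_succ', map_mul, Module.End.mul_apply]
    have h2 := Finset.sum_range_succ' (fun i => ρ (g ^ i) y) p
    rw [Finset.sum_range_succ, hgp, pow_zero] at h2
    rw [h1, hT]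
    exact (add_right_cancel h2).symm
  have hxT : ∀ l, T l ≠ x := fun l hl => by
    have h1 : (ι (-l) * t) ^ p = 1 := by
      rw [h.mul_pow, ht, ← hx, ← h.map_add]
      change ι (T (-l) + x) = 1
      rw [map_neg, hl, neg_add_cancel, h.map_zero]
    have h2 := congrArg π (htf _ (isOfFinOrder_iff_pow_eq_one.2 ⟨p, hp.pos, h1⟩))
    rw [map_mul, h.proj, one_mul, ht, map_one] at h2
    rw [h2, orderOf_one] at hg
    exact hp.ne_one hg.symm
  obtain ⟨φ, hφ⟩ := exists_dual_not_dvd p (⟨T x, x, rfl⟩ : LinearMap.range T) (by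
    rintro ⟨⟨_, l, rfl⟩, hl⟩
    have h1 : T x = p • T l := congrArg Subtype.val hl
    rw [hfix x hxfix] at h1
    refine hxT l (sub_eq_zero.1 (Module.Free.nsmul_eq_zero p _ hp.ne_zero ?_))
    rw [smul_sub, h1, sub_self])
  refine ⟨φ ∘ₗ T.rangeRestrict, fun e he a ha hdvd => hφ ?_⟩
  obtain ⟨l, hl⟩ := (h.exact (e * t⁻¹)).1 (by rw [map_mul, map_inv, he, ht, mul_inv_cancel])
  have h1 : a = T l + x := by
    apply h.injective
    rw [ha, h.map_add, hx, show e = ι l * t by rw [hl]; group, h.mul_pow, ht]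
  have h2 : T.rangeRestrict a = p • T.rangeRestrict l + ⟨T x, x, rfl⟩ := by
    ext
    change T a = p • T l + T x
    rw [h1, map_add, hfix _ (hTfix l)]
  rw [LinearMap.comp_apply, h2, map_add, map_nsmul] at hdvd
  refine (Int.dvd_add_right ?_).1 hdvd
  exact ⟨_, nsmul_eq_mul _ _⟩

theorem torsionFree_quotient_iff (h : IsExtension ρ ι π) (N : Submodule ℤ A)
    [(h.sub N).Normal] : TorsionFree (E ⧸ h.sub N) ↔
      ∀ (e : E) (k : ℕ), k ≠ 0 → e ^ k ∈ h.sub N → e ∈ h.sub N := by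
  constructor
  · intro htf e k hk he
    rw [← QuotientGroup.eq_one_iff] at he ⊢
    exact htf _ (isOfFinOrder_iff_pow_eq_one.2 ⟨k, Nat.pos_of_ne_zero hk, he⟩)
  · intro hall x hx
    obtain ⟨e, rfl⟩ := QuotientGroup.mk_surjective x
    obtain ⟨k, hk, hek⟩ := isOfFinOrder_iff_pow_eq_one.1 hx
    rw [QuotientGroup.eq_one_iff]
    exact hall e k hk.ne' ((QuotientGroup.eq_one_iff _).1 hek)

/-- Vasquez's theorem, for extensions. -/
theorem exists_torsionFree_quotient [Finite G] [Module.Free ℤ A] [Module.Finite ℤ A]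
    (h : IsExtension ρ ι π) (htf : TorsionFree E) :
    ∃ (N : Submodule ℤ A) (hN : ∀ g : G, N ≤ N.comap (ρ g)), IsZPure N ∧
      Module.finrank ℤ (A ⧸ N) ≤ Nat.card (G × G) ∧
      haveI := h.sub_normal N hN
      TorsionFree (E ⧸ h.sub N) := by
  have : ∀ g : G, ∃ ψ : A →ₗ[ℤ] ℤ, (orderOf g).Prime →
      ∀ e : E, π e = g → ∀ a, ι a = e ^ orderOf g → ¬ (orderOf g : ℤ) ∣ ψ a := fun g => by
    by_cases hp : (orderOf g).Prime
    · obtain ⟨ψ, hψ⟩ := h.exists_detecting_functional htf g _ hp rfl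
      exact ⟨ψ, fun _ => hψ⟩
    -- Elements whose order is not prime impose no condition; the zero functional is a filler.
    · exact ⟨0, fun h => absurd h hp⟩
  choose ψ hψ using this
  -- Taking all translates of each `ψ g` makes the kernel stable under `G`; it is pure because the
  -- target is torsion-free.
  let Φ : A →ₗ[ℤ] (G × G → ℤ) := LinearMap.pi fun q => ψ q.1 ∘ₗ ρ q.2
  have hmem : ∀ a, a ∈ LinearMap.ker Φ ↔ ∀ g k, ψ g (ρ k a) = 0 := fun a => by
    rw [LinearMap.mem_ker, funext_iff, Prod.forall]; rfl
  have hN : ∀ g : G, LinearMap.ker Φ ≤ (LinearMap.ker Φ).comap (ρ g) := fun g a ha => by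
    rw [Submodule.mem_comap, hmem]
    intro g' k
    rw [← Module.End.mul_apply, ← map_mul]
    exact (hmem a).1 ha _ _
  have hpure : IsZPure (LinearMap.ker Φ) := by
    rw [isZPure_iff]
    intro k x hk hx
    rw [LinearMap.mem_ker, map_nsmul] at hx
    exact Module.Free.nsmul_eq_zero k _ hk hx
  refine ⟨LinearMap.ker Φ, hN, hpure, ?_, ?_⟩
  · rw [Φ.quotKerEquivRange.finrank_eq]
    cases nonempty_fintype G
    refine (Submodule.finrank_le _).trans ?_
    rw [Module.finrank_fintype_fun_eq_card, Nat.card_eq_fintype_card]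
  · have := h.sub_normal _ hN
    refine TorsionFree.of_prime fun x p hp hxp => ?_
    obtain ⟨e, rfl⟩ := QuotientGroup.mk_surjective x
    rw [← QuotientGroup.mk_pow, QuotientGroup.eq_one_iff] at hxp
    obtain ⟨a, ha, hae⟩ := hxp
    by_cases hg : π e = 1
    · obtain ⟨b, rfl⟩ := (h.exact e).1 hg
      rw [← h.map_nsmul] at hae
      rw [h.injective hae] at ha
      rw [QuotientGroup.eq_one_iff, h.ι_mem_sub]
      exact (isZPure_iff _).1 hpure p b hp.ne_zero ha
    -- Otherwise `π e` has order `p` and `e ^ p` comes from the kernel of `Φ`, so `ψ (π e)` takes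
    -- there the value `0`, which `p` divides.
    · exfalso
      have := Fact.mk hp
      have hord : orderOf (π e) = p :=
        orderOf_eq_prime (by rw [← map_pow, ← hae, h.proj]) hg
      have := hψ (π e) (hord ▸ hp) e rfl a (by rw [hord, hae])
      apply this
      have h0 := (hmem a).1 ha (π e) 1
      rw [map_one, Module.End.one_apply] at h0
      rw [h0]
      exact dvd_zero _

end IsExtension

theorem exists_isVasquezBound (G : Type) [Group G] [Finite G] :
    IsVasquezBound G (Nat.card (G × G)) := by
  intro L _ _ _ ρ _ α hα
  induction α using groupCohomology.H2_induction_on with | h f => ?_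
  obtain ⟨E, _, ι, π, h, hf⟩ := exists_extension f
  have htf := (isSpecial_iff_torsionFree Module.Free.nsmul_eq_zero h f hf).1 hα
  obtain ⟨N, hN, hpure, hrank, hq⟩ := h.exists_torsionFree_quotient htf
  refine ⟨N, hN, hpure, hrank, ?_⟩
  obtain ⟨f', hf', hqf⟩ := quotientH2_apply N hN f
  have := h.sub_normal N hN
  obtain ⟨ι', π', h', hfs⟩ := h.quotient N hN
  rw [hqf, isSpecial_iff_torsionFree (hpure.nsmul_eq_zero) h']
  · exact hq
  · have := hfs _ hf
    rwa [show (fun p => N.mkQ (f p)) = f' from (funext hf').symm] at this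

/-! ### Equivariant complex structures on real representations of groups of odd order -/

/-- The real representation `ρ` has an equivariant complex structure. -/
def HasComplexStructure {G V : Type} [Group G] [AddCommGroup V] [Module ℝ V]
    (ρ : Representation ℝ G V) : Prop :=
  ∃ J : V →ₗ[ℝ] V, (∀ v, J (J v) = -v) ∧ ∀ g v, J (ρ g v) = ρ g (J v)

/-- In odd dimension the square of `det J` would be `-1`. -/
theorem even_finrank_of_sq_eq_neg {V : Type} [AddCommGroup V] [Module ℝ V]
    [FiniteDimensional ℝ V] (J : V →ₗ[ℝ] V) (hJ : ∀ v, J (J v) = -v) :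
    Even (Module.finrank ℝ V) := by
  by_contra h
  have h1 : J * J = (-1 : ℝ) • (1 : Module.End ℝ V) := by
    ext v; simp [hJ]
  have h2 := congrArg LinearMap.det h1
  rw [map_mul, LinearMap.det_smul, (Nat.not_even_iff_odd.1 h).neg_one_pow, map_one] at h2
  nlinarith [mul_self_nonneg (LinearMap.det J)]

section

variable {G V : Type} [Group G] [AddCommGroup V] [Module ℝ V] {ρ : Representation ℝ G V}

theorem HasComplexStructure.of_isCompl {W W' : Submodule ℝ V} (hc : IsCompl W W')
    (hW : ∀ g, W ≤ W.comap (ρ g)) (hW' : ∀ g, W' ≤ W'.comap (ρ g))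
    (h : HasComplexStructure (ρ.subrepresentation W hW))
    (h' : HasComplexStructure (ρ.subrepresentation W' hW')) : HasComplexStructure ρ := by
  obtain ⟨J, hJ, hJρ⟩ := h
  obtain ⟨J', hJ', hJρ'⟩ := h'
  let e := Submodule.prodEquivOfIsCompl W W' hc
  have he : ∀ x, e x = x.1 + x.2 := fun x => rfl
  have hρ : ∀ g x, ρ g (e x) =
      e (ρ.subrepresentation W hW g x.1, ρ.subrepresentation W' hW' g x.2) := fun g x => by
    rw [he, he, map_add]; rfl
  refine ⟨e.toLinearMap ∘ₗ (J.prodMap J') ∘ₗ e.symm.toLinearMap, fun v => ?_, fun g v => ?_⟩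
  · obtain ⟨x, rfl⟩ := e.surjective v
    simp only [LinearMap.comp_apply, LinearEquiv.coe_coe, e.symm_apply_apply,
      LinearMap.prodMap_apply, hJ, hJ']
    exact map_neg e x
  · obtain ⟨x, rfl⟩ := e.surjective v
    rw [hρ]
    simp only [LinearMap.comp_apply, LinearEquiv.coe_coe, e.symm_apply_apply,
      LinearMap.prodMap_apply, hJρ, hJρ', hρ]

theorem hasComplexStructure_of_trivial [FiniteDimensional ℝ V] (hρ : ∀ g v, ρ g v = v)
    (hV : Even (Module.finrank ℝ V)) : HasComplexStructure ρ := by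
  obtain ⟨k, hk⟩ := hV
  let e : V ≃ₗ[ℝ] (Fin k → ℝ) × (Fin k → ℝ) := LinearEquiv.ofFinrankEq _ _ (by simp [hk])
  let I : (Fin k → ℝ) × (Fin k → ℝ) →ₗ[ℝ] (Fin k → ℝ) × (Fin k → ℝ) :=
    (-LinearMap.snd ℝ _ _).prod (LinearMap.fst ℝ _ _)
  refine ⟨e.symm.toLinearMap ∘ₗ I ∘ₗ e.toLinearMap, fun v => ?_, fun g v => by simp [hρ]⟩
  apply e.injective
  simp [I]
  rfl

variable [Finite G]

/-- A Frobenius–Schur argument. The operators `S x y` are averages over `G` of the skew operators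
attached to `x ∧ y`. If all vanish, summing matrix coefficients gives `∑ χ(g)² = ∑ χ(g²)` for the
character `χ`. Squaring permutes a group of odd order, so the right side is `∑ χ(g)`, which is `0`
without invariants. But the left side contains `(dim V)² > 0`. -/
theorem exists_skew_of_odd {V : Type} [NormedAddCommGroup V] [InnerProductSpace ℝ V]
    [FiniteDimensional ℝ V] [Nontrivial V] (ρ : Representation ℝ G V) (hG : Odd (Nat.card G))
    (hρ : ∀ g x y, inner ℝ (ρ g x) (ρ g y) = inner ℝ x y)
    (hfix : ∀ v, (∀ g, ρ g v = v) → v = 0) :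
    ∃ S : V →ₗ[ℝ] V, S ≠ 0 ∧ (∀ x y, inner ℝ (S x) y = -inner ℝ x (S y)) ∧
      ∀ g v, S (ρ g v) = ρ g (S v) := by
  cases nonempty_fintype G
  have hinv : ∀ g x y, inner ℝ (ρ g x) y = inner ℝ x (ρ g⁻¹ y) := fun g x y => by
    rw [← hρ g x, ← Module.End.mul_apply, ← map_mul, mul_inv_cancel, map_one,
      Module.End.one_apply]
  let S (x y : V) : V →ₗ[ℝ] V := ∑ g,
    ((innerₛₗ ℝ (ρ g y)).smulRight (ρ g x) - (innerₛₗ ℝ (ρ g x)).smulRight (ρ g y))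
  have hS : ∀ x y v, S x y v = ∑ g,
      (inner ℝ (ρ g y) v • ρ g x - inner ℝ (ρ g x) v • ρ g y) := fun x y v => by
    simp [S]
  have hS0 : ∃ x y, S x y ≠ 0 := by
    by_contra! h0
    let b := stdOrthonormalBasis ℝ V
    -- The `(i, j)` matrix entry of `S (b i) (b j) = 0`; summed over `i, j` the two sides become `∑
    -- χ(g)²` and `∑ χ(g²)`.
    have key : ∀ i j, ∑ g, inner ℝ (b j) (ρ g (b j)) * inner ℝ (b i) (ρ g (b i)) =
        ∑ g, inner ℝ (b j) (ρ g (b i)) * inner ℝ (b i) (ρ g (b j)) := fun i j => by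
      have h1 := congrArg (inner ℝ (b i)) (LinearMap.congr_fun (h0 (b i) (b j)) (b j))
      rw [hS, LinearMap.zero_apply, inner_zero_right, inner_sum] at h1
      rw [← sub_eq_zero, ← Finset.sum_sub_distrib, ← h1]
      refine Finset.sum_congr rfl fun g _ => ?_
      rw [inner_sub_right, inner_smul_right, inner_smul_right, real_inner_comm (b j),
        real_inner_comm (b j)]
    have htr : ∀ T : V →ₗ[ℝ] V, LinearMap.trace ℝ V T = ∑ i, inner ℝ (b i) (T (b i)) :=
      fun T => LinearMap.trace_eq_sum_inner T b
    have hl : ∑ i, ∑ j, ∑ g, inner ℝ (b j) (ρ g (b j)) * inner ℝ (b i) (ρ g (b i)) =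
        ∑ g, LinearMap.trace ℝ V (ρ g) ^ 2 := by
      rw [Finset.sum_congr rfl fun i _ => Finset.sum_comm, Finset.sum_comm]
      refine Finset.sum_congr rfl fun g _ => ?_
      rw [htr, sq, Finset.sum_mul_sum, Finset.sum_comm]
    have hr : ∑ i, ∑ j, ∑ g, inner ℝ (b j) (ρ g (b i)) * inner ℝ (b i) (ρ g (b j)) =
        ∑ g, LinearMap.trace ℝ V (ρ (g ^ 2)) := by
      rw [Finset.sum_comm, Finset.sum_congr rfl fun i _ => Finset.sum_comm, Finset.sum_comm]
      refine Finset.sum_congr rfl fun g _ => ?_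
      rw [htr]
      refine Finset.sum_congr rfl fun j _ => ?_
      have : ∀ i, inner ℝ (b j) (ρ g (b i)) = inner ℝ (ρ g⁻¹ (b j)) (b i) := fun i => by
        rw [hinv, inv_inv]
      rw [Finset.sum_congr rfl fun i _ => by rw [this i], b.sum_inner_mul_inner, hinv, inv_inv,
        sq, map_mul, Module.End.mul_apply]
    have hsum : ∑ g, ρ g = 0 := by
      ext v
      apply hfix
      intro k
      rw [LinearMap.sum_apply, map_sum]
      refine Fintype.sum_equiv (Equiv.mulLeft k) _ _ fun g => ?_
      rw [Equiv.coe_mulLeft, map_mul, Module.End.mul_apply]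
    have hsq : ∑ g, LinearMap.trace ℝ V (ρ (g ^ 2)) = ∑ g, LinearMap.trace ℝ V (ρ g) :=
      Fintype.sum_equiv (powCoprime (n := 2) (Nat.coprime_two_right.2 hG)) _ _ fun g => rfl
    have htot : ∑ g, LinearMap.trace ℝ V (ρ g) ^ 2 = 0 := by
      rw [← hl, Finset.sum_congr rfl fun i _ => Finset.sum_congr rfl fun j _ => key i j, hr, hsq,
        ← map_sum, hsum, map_zero]
    have h1 := (Finset.sum_eq_zero_iff_of_nonneg fun g _ => sq_nonneg _).1 htot 1
      (Finset.mem_univ _)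
    rw [map_one, LinearMap.trace_one, sq_eq_zero_iff, Nat.cast_eq_zero] at h1
    exact Module.finrank_pos.ne' h1
  obtain ⟨x, y, hxy⟩ := hS0
  refine ⟨S x y, hxy, fun v w => ?_, fun k v => ?_⟩
  · rw [hS, hS, sum_inner, inner_sum, ← Finset.sum_neg_distrib]
    refine Finset.sum_congr rfl fun g _ => ?_
    rw [inner_sub_left, inner_sub_right, inner_smul_left, inner_smul_left, inner_smul_right,
      inner_smul_right, real_inner_comm v, real_inner_comm v]
    simp only [conj_trivial]
    ring
  · rw [hS, hS, map_sum]
    refine (Fintype.sum_equiv (Equiv.mulLeft k) _ _ fun g => ?_).symm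
    rw [Equiv.coe_mulLeft, map_mul, Module.End.mul_apply, Module.End.mul_apply, hρ, hρ,
      map_sub, map_smul, map_smul]

/-- For an equivariant skew `S ≠ 0`, the symmetric operator `S²` has a negative eigenvalue `μ`. On
its eigenspace `W`, `S / √(-μ)` is a complex structure; the orthogonal complement of `W` is smaller
and again without invariants, so induction applies. -/
theorem hasComplexStructure_of_orthogonal (hG : Odd (Nat.card G)) (n : ℕ) :
    ∀ (V : Type) [NormedAddCommGroup V] [InnerProductSpace ℝ V] [FiniteDimensional ℝ V]
      (ρ : Representation ℝ G V), Module.finrank ℝ V = n →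
      (∀ g x y, inner ℝ (ρ g x) (ρ g y) = inner ℝ x y) →
      (∀ v, (∀ g, ρ g v = v) → v = 0) → HasComplexStructure ρ := by
  induction n using Nat.strong_induction_on with | _ n ih => ?_
  intro V _ _ _ ρ hn hρ hfix
  rcases subsingleton_or_nontrivial V with hV | hV
  · exact ⟨0, fun v => Subsingleton.elim _ _, fun g v => Subsingleton.elim _ _⟩
  obtain ⟨S, hS0, hskew, hcomm⟩ := exists_skew_of_odd ρ hG hρ hfix
  have hsymm : (S ∘ₗ S).IsSymmetric := fun x y => by
    simp [hskew]
  obtain ⟨i, hi⟩ : ∃ i, hsymm.eigenvalues rfl i ≠ 0 := by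
    -- If all eigenvalues vanish then `S² = 0`, and `‖S v‖² = -⟨v, S² v⟩` gives `S = 0`.
    by_contra! h0
    apply hS0
    have h1 : S ∘ₗ S = 0 := (hsymm.eigenvectorBasis rfl).toBasis.ext fun i => by
      rw [OrthonormalBasis.coe_toBasis, hsymm.apply_eigenvectorBasis, h0]; simp
    ext v
    have h2 := hskew v (S v)
    rw [← LinearMap.comp_apply, h1, LinearMap.zero_apply, inner_zero_right, neg_zero,
      inner_self_eq_zero] at h2
    exact h2
  set μ := hsymm.eigenvalues rfl i with hμ
  let u := hsymm.eigenvectorBasis rfl i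
  have hu : S (S u) = μ • u := hsymm.apply_eigenvectorBasis rfl i
  have hu1 : inner ℝ u u = (1 : ℝ) := by simp [u]
  -- For the unit eigenvector `u`, `‖S u‖² = -⟨u, S² u⟩ = -μ`.
  have hμneg : μ < 0 := by
    refine lt_of_le_of_ne ?_ hi
    have h1 := hskew u (S u)
    rw [hu, inner_smul_right, hu1, mul_one] at h1
    have := real_inner_self_nonneg (x := S u)
    linarith
  let W : Submodule ℝ V := LinearMap.ker (S ∘ₗ S - μ • LinearMap.id)
  have hWmem : ∀ v, v ∈ W ↔ S (S v) = μ • v := fun v => by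
    simp [W, sub_eq_zero]
  have hW : ∀ g, W ≤ W.comap (ρ g) := fun g v hv => by
    rw [Submodule.mem_comap, hWmem, hcomm, hcomm, (hWmem v).1 hv, map_smul]
  have hinv : ∀ g x y, inner ℝ (ρ g x) y = inner ℝ x (ρ g⁻¹ y) := fun g x y => by
    rw [← hρ g x, ← Module.End.mul_apply, ← map_mul, mul_inv_cancel, map_one,
      Module.End.one_apply]
  have hW' : ∀ g, Wᗮ ≤ Wᗮ.comap (ρ g) := fun g v hv => by
    rw [Submodule.mem_comap, Submodule.mem_orthogonal']
    intro w hw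
    rw [hinv]
    exact (Submodule.mem_orthogonal' _ _).1 hv _ (hW _ hw)
  have huW : u ∈ W := (hWmem u).2 hu
  have hu0 : u ≠ 0 := fun h => by simp [h] at hu1
  refine HasComplexStructure.of_isCompl W.isCompl_orthogonal hW hW' ?_ ?_
  · have hSW : ∀ v ∈ W, S v ∈ W := fun v hv => by
      rw [hWmem, (hWmem v).1 hv, map_smul]
    have hsq : (Real.sqrt (-μ))⁻¹ * ((Real.sqrt (-μ))⁻¹ * μ) = -1 := by
      have h1 : Real.sqrt (-μ) * Real.sqrt (-μ) = -μ := Real.mul_self_sqrt (by linarith)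
      have h2 : Real.sqrt (-μ) ≠ 0 := (Real.sqrt_pos.2 (by linarith)).ne'
      field_simp
      linarith
    refine ⟨(Real.sqrt (-μ))⁻¹ • S.restrict hSW, fun v => ?_, fun g v => ?_⟩
    · ext
      change (Real.sqrt (-μ))⁻¹ • S ((Real.sqrt (-μ))⁻¹ • S v) = -(v : V)
      rw [map_smul, (hWmem v).1 v.2, smul_smul, smul_smul, mul_assoc, hsq, neg_one_smul]
    · ext
      change (Real.sqrt (-μ))⁻¹ • S (ρ g v) = ρ g ((Real.sqrt (-μ))⁻¹ • S v)
      rw [hcomm, map_smul]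
  · refine ih _ ?_ Wᗮ _ rfl (fun g x y => hρ g x y) fun v hv => ?_
    · rw [← hn, ← W.finrank_add_finrank_orthogonal]
      have : 0 < Module.finrank ℝ W :=
        Module.finrank_pos_iff_exists_ne_zero.2 ⟨⟨u, huW⟩, fun h => hu0 (congrArg Subtype.val h)⟩
      omega
    · ext
      exact hfix v fun g => congrArg Subtype.val (hv g)

/-- Averaging an inner product over `G` reduces to the orthogonal case. The dimension is not assumed
even; that follows from the conclusion. -/
theorem hasComplexStructure_of_no_invariants [FiniteDimensional ℝ V] (ρ : Representation ℝ G V)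
    (hG : Odd (Nat.card G)) (hfix : ∀ v, (∀ g, ρ g v = v) → v = 0) : HasComplexStructure ρ := by
  cases nonempty_fintype G
  let c : V ≃ₗ[ℝ] EuclideanSpace ℝ (Fin (Module.finrank ℝ V)) :=
    LinearEquiv.ofFinrankEq _ _ (by simp)
  let core : InnerProductSpace.Core ℝ V :=
    { inner := fun x y => ∑ g, inner ℝ (c (ρ g x)) (c (ρ g y))
      conj_inner_symm := fun x y => by simp [real_inner_comm]
      re_inner_nonneg := fun x => Finset.sum_nonneg fun g _ => real_inner_self_nonneg
      add_left := fun x y z => by simp [inner_add_left, Finset.sum_add_distrib]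
      smul_left := fun x y r => by simp [inner_smul_left, Finset.mul_sum]
      definite := fun x hx => by
        have := (Finset.sum_eq_zero_iff_of_nonneg fun g _ => real_inner_self_nonneg).1 hx 1
          (Finset.mem_univ _)
        simpa using this }
  let _ : NormedAddCommGroup V := core.toNormedAddCommGroup
  let _ : InnerProductSpace ℝ V := InnerProductSpace.ofCore core.toCore
  refine hasComplexStructure_of_orthogonal hG _ V ρ rfl (fun k x y => ?_) hfix
  change ∑ g, inner ℝ (c (ρ g (ρ k x))) (c (ρ g (ρ k y))) = ∑ g, inner ℝ (c (ρ g x)) (c (ρ g y))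
  refine Fintype.sum_equiv (Equiv.mulRight k) _ _ fun g => ?_
  simp

/-- The norm `P` splits `V` into invariants and `ker P`. The latter has no invariants, so it has a
complex structure and even dimension. Hence the invariants have even dimension too, and any complex
structure on them is equivariant. -/
theorem hasComplexStructure_of_even [FiniteDimensional ℝ V] (ρ : Representation ℝ G V)
    (hG : Odd (Nat.card G)) (hV : Even (Module.finrank ℝ V)) : HasComplexStructure ρ := by
  cases nonempty_fintype G
  let P : V →ₗ[ℝ] V := ∑ g, ρ g
  have hP : ∀ v, P v = ∑ g, ρ g v := fun v => by simp [P]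
  have hρP : ∀ k v, ρ k (P v) = P v := fun k v => by
    rw [hP, map_sum]
    refine Fintype.sum_equiv (Equiv.mulLeft k) _ _ fun g => by simp
  have hPρ : ∀ k v, P (ρ k v) = P v := fun k v => by
    rw [hP, hP]
    refine Fintype.sum_equiv (Equiv.mulRight k) _ _ fun g => by simp
  have hcard : (Fintype.card G : ℝ) ≠ 0 := by simp
  have hfixP : ∀ v ∈ ρ.invariants, P v = (Fintype.card G : ℝ) • v := fun v hv => by
    rw [hP, Finset.sum_congr rfl fun g _ => hv g]
    simp [Nat.cast_smul_eq_nsmul]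
  have hc : IsCompl ρ.invariants (LinearMap.ker P) := by
    constructor
    · rw [Submodule.disjoint_def]
      intro v hv hv'
      rw [LinearMap.mem_ker, hfixP v hv] at hv'
      exact (smul_eq_zero.1 hv').resolve_left hcard
    · rw [codisjoint_iff, eq_top_iff]
      intro v _
      have h1 : (Fintype.card G : ℝ)⁻¹ • P v ∈ ρ.invariants := fun g => by rw [map_smul, hρP]
      refine Submodule.mem_sup.2 ⟨_, h1, v - (Fintype.card G : ℝ)⁻¹ • P v, ?_, by abel⟩
      rw [LinearMap.mem_ker, map_sub, hfixP _ h1, smul_inv_smul₀ hcard, sub_self]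
  have hW : ∀ g, ρ.invariants ≤ ρ.invariants.comap (ρ g) := fun g v hv => by
    rw [Submodule.mem_comap, hv g]; exact hv
  have hW' : ∀ g, LinearMap.ker P ≤ (LinearMap.ker P).comap (ρ g) := fun g v hv => by
    rw [Submodule.mem_comap, LinearMap.mem_ker, hPρ]; exact hv
  have h' : HasComplexStructure (ρ.subrepresentation (LinearMap.ker P) hW') := by
    refine hasComplexStructure_of_no_invariants _ hG fun v hv => ?_
    have h1 : (v : V) ∈ ρ.invariants := fun g => congrArg Subtype.val (hv g)
    have h2 := v.2
    rw [LinearMap.mem_ker, hfixP v h1] at h2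
    exact Subtype.ext ((smul_eq_zero.1 h2).resolve_left hcard)
  refine HasComplexStructure.of_isCompl hc hW hW' ?_ h'
  refine hasComplexStructure_of_trivial (fun g v => Subtype.ext (v.2 g)) ?_
  obtain ⟨J, hJ, -⟩ := h'
  have h1 := even_finrank_of_sq_eq_neg J hJ
  have h2 := Submodule.finrank_add_eq_of_isCompl hc
  rw [← h2] at hV
  exact (Nat.even_add.1 hV).2 h1

end

/-! ### From lattices with a complex structure to aspherical Kähler groups -/

theorem exists_complex_coordinates {V : Type} [AddCommGroup V] [Module ℝ V]
    [FiniteDimensional ℝ V] (J : V →ₗ[ℝ] V) (hJ : ∀ v, J (J v) = -v)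
    {d : ℕ} (hd : Module.finrank ℝ V / 2 = d) :
    ∃ ε : V ≃ₗ[ℝ] EuclideanSpace ℂ (Fin d), ∀ v, ε (J v) = Complex.I • ε v := by
  let φ : ℂ →ₐ[ℝ] Module.End ℝ V := Complex.lift ⟨J, by ext v; simp [hJ]⟩
  let _ : Module ℂ V := Module.compHom V φ.toRingHom
  have hsmul : ∀ (z : ℂ) (v : V), z • v = φ z v := fun z v => rfl
  have : IsScalarTower ℝ ℂ V := ⟨fun r z v => by rw [hsmul, hsmul, map_smul]; rfl⟩
  have : FiniteDimensional ℂ V := FiniteDimensional.right ℝ ℂ V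
  have hd : Module.finrank ℂ V = d := by
    rw [← hd, ← Module.finrank_mul_finrank ℝ ℂ V, Complex.finrank_real_complex]
    omega
  let ε : V ≃ₗ[ℂ] EuclideanSpace ℂ (Fin d) :=
    LinearEquiv.ofFinrankEq _ _ (by simp [hd])
  refine ⟨ε.restrictScalars ℝ, fun v => ?_⟩
  have : Complex.I • v = J v := by
    rw [hsmul]; simp [φ]
  change ε (J v) = Complex.I • ε v
  rw [← this, map_smul]


open scoped TensorProduct

/-- The real representation obtained from an integral one by extension of scalars. -/
noncomputable def realification {G A : Type} [Group G] [AddCommGroup A]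
    (ρ : Representation ℤ G A) : Representation ℝ G (ℝ ⊗[ℤ] A) where
  toFun g := (ρ g).baseChange ℝ
  map_one' := by rw [map_one, Module.End.one_eq_id, LinearMap.baseChange_id]; rfl
  map_mul' g h := by rw [map_mul, Module.End.mul_eq_comp, LinearMap.baseChange_comp]; rfl

theorem realification_tmul {G A : Type} [Group G] [AddCommGroup A]
    (ρ : Representation ℤ G A) (g : G) (r : ℝ) (a : A) :
    realification ρ g (r ⊗ₜ a) = r ⊗ₜ ρ g a := rfl

/-- A homomorphism to the group of affine transformations, given by its linear part and a
cocycle of translation vectors. -/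
theorem exists_affine_action {E C : Type} [Group E] [AddCommGroup C] [Module ℂ C]
    (lin : E →* (C →ₗ[ℂ] C)) (t : E → C) (ht : ∀ e e', t (e * e') = lin e (t e') + t e) :
    ∃ F : E →* (C ≃ᵃ[ℂ] C), ∀ e x, F e x = lin e x + t e := by
  have h1 : t 1 = 0 := by simpa using ht 1 1
  let F : E →* (C →ᵃ[ℂ] C) :=
    { toFun := fun e => (lin e).toAffineMap + AffineMap.const ℂ C (t e)
      map_one' := by ext x; simp [h1]
      map_mul' := fun e e' => by ext x; simp [ht, add_assoc] }
  refine ⟨AffineEquiv.equivUnitsAffineMap.symm.toMonoidHom.comp F.toHomUnits, fun e x => ?_⟩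
  change (lin e).toAffineMap x + AffineMap.const ℂ C (t e) x = _
  simp

namespace IsExtension

variable {G A E : Type} [Group G] [AddCommGroup A] [Group E] {ρ : Representation ℤ G A}
  {ι : A → E} {π : E →* G}

/-- The vanishing of `H²(G, C)` for a complex representation `C` of a finite group, in terms of
extensions: an equivariant map to `C` extends to a crossed homomorphism. -/
theorem exists_crossedHom [Finite G] (h : IsExtension ρ ι π) {C : Type} [AddCommGroup C]
    [Module ℂ C] (lin : G →* (C →ₗ[ℂ] C)) (j : A →+ C) (hj : ∀ g a, lin g (j a) = j (ρ g a)) :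
    ∃ t : E → C, (∀ e e', t (e * e') = lin (π e) (t e') + t e) ∧ ∀ a, t (ι a) = j a := by
  cases nonempty_fintype G
  choose s hs using h.surjective
  -- `κ e g` measures how left multiplication by `e` moves the section; averaging it over `g` in `C`
  -- gives the crossed homomorphism.
  have hκ : ∀ e g, ∃ a, ι a = e * s g * (s (π e * g))⁻¹ := fun e g => by
    rw [← h.exact]; simp [hs]
  choose κ hκ using hκ
  have hcard : (Fintype.card G : ℂ) ≠ 0 := by simp
  refine ⟨fun e => (Fintype.card G : ℂ)⁻¹ • ∑ g, j (κ e g), fun e e' => ?_, fun a => ?_⟩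
  · have h1 : ∀ g, κ (e * e') g = ρ (π e) (κ e' g) + κ e (π e' * g) := fun g => by
      apply h.injective
      rw [h.map_add, h.conj, hκ, hκ, hκ, map_mul, mul_assoc (π e)]
      group
    simp only [h1, map_add, Finset.sum_add_distrib, smul_add, map_smul, map_sum, hj]
    congr 2
    exact Fintype.sum_equiv (Equiv.mulLeft (π e')) _ _ fun g => rfl
  · have h1 : ∀ g, κ (ι a) g = a := fun g => by
      apply h.injective
      rw [hκ, h.proj, one_mul, mul_inv_cancel_right]
    simp only [h1]
    rw [Finset.sum_const, Finset.card_univ, ← Nat.cast_smul_eq_nsmul ℂ, inv_smul_smul₀ hcard]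

/-- The complex structure turns `ℝ ⊗ A` into a complex space on which `G` acts linearly; a crossed
homomorphism extending the inclusion of `A` lets `E` act affinely. If `e` fixes a point, so does the
translation `e ^ |G|`, which is therefore trivial; then `e` is torsion and `e = 1`. -/
theorem isAsphericalKahlerGroup [Finite G] [Module.Free ℤ A] [Module.Finite ℤ A]
    (h : IsExtension ρ ι π) (htf : TorsionFree E) (hJ : HasComplexStructure (realification ρ)) :
    IsAsphericalKahlerGroup (Module.finrank ℤ A / 2) E := by
  obtain ⟨J, hJ, hJρ⟩ := hJ
  obtain ⟨ε, hε⟩ := exists_complex_coordinates J hJ (d := Module.finrank ℤ A / 2)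
    (by rw [Module.finrank_baseChange])
  generalize Module.finrank ℤ A / 2 = d at ε hε
  let C := EuclideanSpace ℂ (Fin d)
  have hlin : ∀ g (z : ℂ) (x : C),
      ε (realification ρ g (ε.symm (z • x))) = z • ε (realification ρ g (ε.symm x)) := by
    intro g z x
    obtain ⟨v, rfl⟩ := ε.surjective x
    have h2 : ∀ w, z • ε w = ε (z.re • w + z.im • J w) := fun w => by
      conv_lhs => rw [← Complex.re_add_im z]
      rw [map_add, map_smul, map_smul, hε, add_smul, mul_smul, Complex.coe_smul, Complex.coe_smul]
    rw [h2, ε.symm_apply_apply, ε.symm_apply_apply, h2]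
    simp only [map_add, map_smul, hJρ]
  let lin : G →* (C →ₗ[ℂ] C) :=
    { toFun := fun g =>
        { toFun := fun x => ε (realification ρ g (ε.symm x))
          map_add' := fun x y => by simp
          map_smul' := hlin g }
      map_one' := by ext1 x; simp
      map_mul' := fun g k => by ext1 x; simp }
  let j : A →+ C := AddMonoidHom.mk' (fun a => ε (1 ⊗ₜ a)) fun a b => by
    rw [TensorProduct.tmul_add, map_add]
  have hjlin : ∀ g a, lin g (j a) = j (ρ g a) := fun g a => by
    change ε (realification ρ g (ε.symm (ε (1 ⊗ₜ a)))) = ε (1 ⊗ₜ ρ g a)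
    rw [ε.symm_apply_apply, realification_tmul]
  let b := Module.Free.chooseBasis ℤ A
  let b' : Module.Basis _ ℝ C := (Algebra.TensorProduct.basis ℝ b).map ε
  have hb' : ∀ i, b' i = j (b i) := fun i => by
    simp [b', j]
  have hjinj : Function.Injective j := by
    intro x y hxy
    have h1 : (1 : ℝ) ⊗ₜ[ℤ] x = 1 ⊗ₜ[ℤ] y := ε.injective hxy
    refine b.ext_elem fun i => ?_
    have h2 := congrArg (fun z => (Algebra.TensorProduct.basis ℝ b).repr z i) h1
    simpa using h2
  obtain ⟨t, ht, htj⟩ := h.exists_crossedHom lin j hjlin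
  obtain ⟨F, hF⟩ := exists_affine_action (lin.comp π) t ht
  have hFι : ∀ a x, F (ι a) x = x + j a := fun a x => by
    rw [hF, htj, MonoidHom.comp_apply, h.proj, map_one, Module.End.one_apply]
  have hpow : ∀ e : E, ∃ a, ι a = e ^ Nat.card G := fun e => by
    rw [← h.exact, map_pow, pow_card_eq_one']
  have hcard : Nat.card G ≠ 0 := Nat.card_pos.ne'
  refine ⟨F, fun e he x hx => he ?_, ?_, ?_, ?_⟩
  · obtain ⟨a, ha⟩ := hpow e
    have h1 : ∀ k : ℕ, F (e ^ k) x = x := fun k => by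
      induction k with
      | zero => simp
      | succ k ih => rw [pow_succ, map_mul, AffineEquiv.mul_def, AffineEquiv.trans_apply, hx, ih]
    have h2 := h1 (Nat.card G)
    rw [← ha, hFι, add_eq_left] at h2
    have h3 : a = 0 := hjinj (by rw [h2, map_zero])
    exact htf e (isOfFinOrder_iff_pow_eq_one.2
      ⟨_, Nat.pos_of_ne_zero hcard, by rw [← ha, h3, h.map_zero]⟩)
  · have hc : (Nat.card G : ℝ)⁻¹ ≠ 0 := inv_ne_zero (Nat.cast_ne_zero.2 hcard)
    let b'' := b'.map (LinearEquiv.smulOfNeZero ℝ C _ hc)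
    -- As `ρ` may have a kernel, translations need not come from `A`. Their `|G|`-th powers do, so
    -- all translation vectors lie in the lattice `|G|⁻¹ • j A`.
    have hsub : (translationVectors F : Set C) ⊆ Submodule.span ℤ (Set.range b'') := by
      rintro v ⟨e, hv⟩
      obtain ⟨a, ha⟩ := hpow e
      have h1 : ∀ k : ℕ, ∀ x, F (e ^ k) x = k • v + x := fun k => by
        induction k with
        | zero => simp
        | succ k ih =>
          intro x
          rw [pow_succ, map_mul, AffineEquiv.mul_def, AffineEquiv.trans_apply, hv, ih, succ_nsmul,
            add_assoc]
      have h2 := h1 (Nat.card G) 0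
      rw [← ha, hFι, zero_add, add_zero] at h2
      have h3 : v = (Nat.card G : ℝ)⁻¹ • j a := by
        rw [h2, ← Nat.cast_smul_eq_nsmul ℝ, inv_smul_smul₀ (Nat.cast_ne_zero.2 hcard)]
      rw [h3, ← b.sum_repr a, map_sum, Finset.smul_sum]
      refine Submodule.sum_mem _ fun i _ => ?_
      rw [map_zsmul, smul_comm, ← hb']
      exact Submodule.smul_mem _ _ (Submodule.subset_span ⟨i, by simp [b'']⟩)
    exact DiscreteTopology.of_subset
      (inferInstanceAs (DiscreteTopology (Submodule.span ℤ (Set.range b'')))) hsub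
  · rw [eq_top_iff, ← b'.span_eq, Submodule.span_le]
    rintro _ ⟨i, rfl⟩
    refine Submodule.subset_span ⟨ι (b i), fun x => ?_⟩
    rw [hFι, hb', add_comm]
  · choose s hs using h.surjective
    refine Finite.of_surjective (fun g : G =>
      (⟨_, s g, rfl⟩ : (AffineEquiv.linearHom.comp F).range)) ?_
    rintro ⟨_, e, rfl⟩
    refine ⟨π e, Subtype.ext ?_⟩
    have h1 : ∀ (e : E) (x : C), (F e).linear x = lin (π e) x := fun e x => by
      have := (F e).map_vadd 0 x
      rw [vadd_eq_add, vadd_eq_add, add_zero, hF, hF, map_zero, zero_add,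
        add_left_inj] at this
      exact this.symm
    ext1 x
    change (F (s (π e))).linear x = (F e).linear x
    rw [h1, h1, hs]

end IsExtension

/-! ### The structure of aspherical Kähler groups -/

section Kahler

variable {n : ℕ} {Γ : Type} [Group Γ]
  {F : Γ →* (EuclideanSpace ℂ (Fin n) ≃ᵃ[ℂ] EuclideanSpace ℂ (Fin n))}

variable (F) in
/-- The subgroup of translations. -/
noncomputable def translationSubgroup : Subgroup Γ := (AffineEquiv.linearHom.comp F).ker

theorem affine_add (γ : Γ) (w x : EuclideanSpace ℂ (Fin n)) :
    F γ (w + x) = (F γ).linear w + F γ x := (F γ).map_vadd x w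

theorem affine_mul (γ δ : Γ) (x : EuclideanSpace ℂ (Fin n)) : F (γ * δ) x = F γ (F δ x) := by
  rw [map_mul]; rfl

theorem mem_translationSubgroup {γ : Γ} :
    γ ∈ translationSubgroup F ↔ ∀ w, (F γ).linear w = w := by
  rw [translationSubgroup, MonoidHom.mem_ker]
  exact ⟨fun h w => LinearEquiv.congr_fun h w, fun h => LinearEquiv.ext h⟩

theorem translationSubgroup_apply {γ : Γ} (hγ : γ ∈ translationSubgroup F)
    (x : EuclideanSpace ℂ (Fin n)) : F γ x = F γ 0 + x := by
  have := affine_add (F := F) γ x 0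
  rw [add_zero, mem_translationSubgroup.1 hγ, add_comm] at this
  exact this

theorem mem_translationSubgroup_of_apply {γ : Γ} {v : EuclideanSpace ℂ (Fin n)}
    (h : ∀ x, F γ x = v + x) : γ ∈ translationSubgroup F := by
  rw [mem_translationSubgroup]
  intro w
  have := affine_add (F := F) γ w 0
  rw [h, h, add_zero, add_zero, add_comm v, add_left_inj] at this
  exact this.symm

variable (F) in
/-- The action is free, with a lattice of finite index of translations. -/
structure IsKahlerAction : Prop where
  free : ∀ γ : Γ, γ ≠ 1 → ∀ x, F γ x ≠ x
  discrete : DiscreteTopology (translationVectors F)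
  span : Submodule.span ℝ (translationVectors F : Set (EuclideanSpace ℂ (Fin n))) = ⊤
  finite : Finite (AffineEquiv.linearHom.comp F).range

namespace IsKahlerAction

theorem eq_one (hF : IsKahlerAction F) {γ : Γ} (x : EuclideanSpace ℂ (Fin n))
    (h : F γ x = x) : γ = 1 := by
  by_contra hne
  exact hF.free γ hne x h

theorem exists_pow_mem (hF : IsKahlerAction F) :
    ∃ k : ℕ, k ≠ 0 ∧ ∀ γ : Γ, γ ^ k ∈ translationSubgroup F := by
  have := hF.finite
  refine ⟨Nat.card (AffineEquiv.linearHom.comp F).range, Nat.card_pos.ne', fun γ => ?_⟩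
  rw [translationSubgroup, MonoidHom.mem_ker, map_pow]
  exact congrArg Subtype.val
    (pow_card_eq_one' (x := (⟨_, γ, rfl⟩ : (AffineEquiv.linearHom.comp F).range)))

/-- An element of finite order fixes the centroid of its orbit of `0`, and the action is free. -/
theorem torsionFree (hF : IsKahlerAction F) : TorsionFree Γ := by
  intro γ hγ
  obtain ⟨k, hk, hγk⟩ := isOfFinOrder_iff_pow_eq_one.1 hγ
  have hk0 : (k : ℂ) ≠ 0 := Nat.cast_ne_zero.2 hk.ne'
  have hlin : ∀ x y, F γ x = (F γ).linear (x - y) + F γ y := fun x y => by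
    rw [← affine_add, sub_add_cancel]
  let c : EuclideanSpace ℂ (Fin n) := (k : ℂ)⁻¹ • ∑ i ∈ Finset.range k, F (γ ^ i) 0
  refine hF.eq_one c ?_
  have h1 : ∑ i ∈ Finset.range k, F γ (F (γ ^ i) 0) = ∑ i ∈ Finset.range k, F (γ ^ i) 0 := by
    have h2 := Finset.sum_range_succ' (fun i => F (γ ^ i) 0) k
    rw [Finset.sum_range_succ, hγk, pow_zero] at h2
    rw [add_right_cancel h2]
    exact Finset.sum_congr rfl fun i _ => by rw [pow_succ', affine_mul]
  have h3 : ∑ i ∈ Finset.range k, F γ (F (γ ^ i) 0) =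
      (F γ).linear (∑ i ∈ Finset.range k, F (γ ^ i) 0) + (k : ℂ) • F γ 0 := by
    rw [Finset.sum_congr rfl fun i _ => hlin (F (γ ^ i) 0) 0, Finset.sum_add_distrib, map_sum]
    simp [Nat.cast_smul_eq_nsmul]
  rw [hlin c 0, sub_zero, map_smul, ← inv_smul_smul₀ hk0 (F γ 0), ← smul_add, ← h3, h1]

/-- An abelian group whose elements act as translations, compatibly, embeds in the lattice. -/
theorem exists_toLattice (hF : IsKahlerAction F) {A : Type} [AddCommGroup A] (κ : A → Γ)
    (hκ : ∀ a b, κ (a + b) = κ a * κ b) (hinj : ∀ a, κ a = 1 → a = 0)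
    (hT : ∀ a, κ a ∈ translationSubgroup F) :
    ∃ τ : A →+ translationVectors F, Function.Injective τ ∧ ∀ a x, F (κ a) x = τ a + x := by
  let τ : A →+ translationVectors F := AddMonoidHom.mk'
    (fun a => ⟨F (κ a) 0, κ a, translationSubgroup_apply (hT a)⟩) fun a b => by
      ext1
      change F (κ (a + b)) 0 = F (κ a) 0 + F (κ b) 0
      rw [hκ, affine_mul, translationSubgroup_apply (hT a)]
  refine ⟨τ, (injective_iff_map_eq_zero τ).2 fun a ha => hinj a ?_, fun a x =>
    translationSubgroup_apply (hT a) x⟩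
  exact hF.eq_one 0 (congrArg Subtype.val ha)

theorem lattice_free (hF : IsKahlerAction F) : Module.Free ℤ (translationVectors F) := by
  have := hF.discrete
  have : DiscreteTopology (AddSubgroup.toIntSubmodule (translationVectors F)) := this
  exact inferInstanceAs (Module.Free ℤ (AddSubgroup.toIntSubmodule (translationVectors F)))

theorem lattice_finite (hF : IsKahlerAction F) : Module.Finite ℤ (translationVectors F) := by
  have := hF.discrete
  have : DiscreteTopology (AddSubgroup.toIntSubmodule (translationVectors F)) := this
  exact inferInstanceAs (Module.Finite ℤ (AddSubgroup.toIntSubmodule (translationVectors F)))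

theorem lattice_finrank (hF : IsKahlerAction F) :
    Module.finrank ℤ (translationVectors F) = 2 * n := by
  have := hF.discrete
  have : DiscreteTopology (AddSubgroup.toIntSubmodule (translationVectors F)) := this
  have : IsZLattice ℝ (AddSubgroup.toIntSubmodule (translationVectors F)) := ⟨hF.span⟩
  have h := ZLattice.rank ℝ (AddSubgroup.toIntSubmodule (translationVectors F))
  rw [← Module.finrank_mul_finrank ℝ ℂ, Complex.finrank_real_complex,
    finrank_euclideanSpace_fin] at h
  exact h

/-- The rank of the kernel of an extension by a finite group which acts as a Kähler group. -/
theorem finrank_le (hF : IsKahlerAction F) {G A : Type} [Group G] [AddCommGroup A]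
    [Module.Free ℤ A] {ρ : Representation ℤ G A} {ι : A → Γ} {π : Γ →* G}
    (h : IsExtension ρ ι π) : Module.finrank ℤ A ≤ 2 * n := by
  obtain ⟨k, hk, hkT⟩ := hF.exists_pow_mem
  -- The kernel need not a priori consist of translations, but its `k`-th powers do, and
  -- multiplication by `k` is injective on `A`.
  obtain ⟨τ, hτ, -⟩ := hF.exists_toLattice (fun a => ι (k • a))
    (fun a b => by rw [smul_add, h.map_add])
    (fun a ha => Module.Free.nsmul_eq_zero k a hk (h.injective (by rw [ha, h.map_zero])))
    (fun a => by rw [h.map_nsmul]; exact hkT _)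
  have := hF.lattice_free
  have := hF.lattice_finite
  rw [← hF.lattice_finrank]
  exact LinearMap.finrank_le_finrank_of_injective (f := τ.toIntLinearMap) hτ

/-- Commuting with the translation by `v` means that the linear part fixes `v`, and these vectors
span over `ℝ`. -/
theorem mem_translationSubgroup_of_commute (hF : IsKahlerAction F) {γ : Γ}
    (h : ∀ t ∈ translationSubgroup F, γ * t = t * γ) : γ ∈ translationSubgroup F := by
  rw [mem_translationSubgroup]
  intro w
  have hw : w ∈ Submodule.span ℝ (translationVectors F : Set (EuclideanSpace ℂ (Fin n))) := by
    rw [hF.span]; trivial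
  induction hw using Submodule.span_induction with
  | mem v hv =>
    obtain ⟨t, ht⟩ := hv
    have h1 := congrArg (fun δ => F δ 0) (h t (mem_translationSubgroup_of_apply ht))
    simp only [affine_mul, ht] at h1
    rw [affine_add, add_left_inj] at h1
    exact h1
  | zero => exact map_zero _
  | add x y _ _ hx hy => rw [map_add, hx, hy]
  | smul r x _ hx =>
    rw [← Complex.coe_smul, map_smul, hx]

theorem commute_of_mem (hF : IsKahlerAction F) {s t : Γ} (hs : s ∈ translationSubgroup F)
    (ht : t ∈ translationSubgroup F) : s * t = t * s := by
  rw [← mul_inv_eq_one]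
  refine hF.eq_one (F (t * s) 0) ?_
  rw [← affine_mul, inv_mul_cancel_right, affine_mul, affine_mul,
    translationSubgroup_apply hs, translationSubgroup_apply ht (F s 0), add_comm]

/-- For `a ∈ B` and a translation `t` by `v`, the commutator `c` of `a` and `t` is a translation by
some `w` and lies in `B`, so it commutes with `a`. The linear part of `a` thus sends `v` to `w + v`
and fixes `w`; its `i`-th power sends `v` to `i • w + v`. Having finite order, it forces `w = 0`. So
`a` commutes with all translations and is one. -/
theorem le_translationSubgroup (hF : IsKahlerAction F) (B : Subgroup Γ) [B.Normal]
    (hB : ∀ a ∈ B, ∀ b ∈ B, a * b = b * a) : B ≤ translationSubgroup F := by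
  intro a ha
  refine hF.mem_translationSubgroup_of_commute fun t ht => ?_
  have hcB : a * t * a⁻¹ * t⁻¹ ∈ B := by
    have := B.mul_mem ha (Subgroup.Normal.conj_mem ‹_› _ (B.inv_mem ha) t)
    simpa only [mul_assoc] using this
  set c := a * t * a⁻¹ * t⁻¹ with hc
  have hcT : c ∈ translationSubgroup F := by
    have hn : (translationSubgroup F).Normal := MonoidHom.normal_ker _
    exact mul_mem (hn.conj_mem _ ht a) (inv_mem ht)
  have hat : a * t = c * (t * a) := by rw [hc]; group
  let v := F t 0
  let w := F c 0
  have hav : (F a).linear v = w + v := by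
    have h1 := congrArg (fun δ => F δ 0) hat
    simp only [affine_mul] at h1
    rw [translationSubgroup_apply ht (F a 0), translationSubgroup_apply hcT] at h1
    have h2 := affine_add (F := F) a (F t 0) 0
    rw [add_zero, h1, ← add_assoc, add_left_inj] at h2
    exact h2.symm
  have haw : (F a).linear w = w := by
    have h1 := congrArg (fun δ => F δ 0) (hB a ha c hcB)
    simp only [affine_mul] at h1
    rw [translationSubgroup_apply hcT (F a 0)] at h1
    have h2 := affine_add (F := F) a (F c 0) 0
    rw [add_zero, h1, add_left_inj] at h2
    exact h2.symm
  obtain ⟨k, hk, hkT⟩ := hF.exists_pow_mem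
  have hpow : ∀ i : ℕ, (F (a ^ i)).linear v = i • w + v := fun i => by
    induction i with
    | zero => rw [pow_zero, map_one, zero_smul, zero_add]; rfl
    | succ i ih =>
      have h1 : (F (a ^ (i + 1))).linear v = (F a).linear ((F (a ^ i)).linear v) := by
        rw [pow_succ', map_mul]; rfl
      rw [h1, ih, map_add, map_nsmul, haw, hav, succ_nsmul, add_assoc]
  have h1 := hpow k
  rw [mem_translationSubgroup.1 (hkT a), right_eq_add, ← Nat.cast_smul_eq_nsmul ℂ, smul_eq_zero,
    Nat.cast_eq_zero] at h1
  have h2 : c = 1 := hF.eq_one 0 (h1.resolve_left hk)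
  rw [hat, h2, one_mul]

theorem eq_translationSubgroup (hF : IsKahlerAction F) {L : Subgroup Γ}
    (hL : IsMaximalAbelianNormal L) : L = translationSubgroup F := by
  have := hL.1.1
  have hle := hF.le_translationSubgroup L hL.1.2
  exact le_antisymm hle
    (hL.2 ⟨MonoidHom.normal_ker _, fun a ha b hb => hF.commute_of_mem ha hb⟩ hle)

end IsKahlerAction

end Kahler

/-- A group with an abelian normal subgroup is an extension. -/
theorem exists_isExtension {G E : Type} [Group G] [Group E] (π : E →* G)
    (hπ : Function.Surjective π) (hcomm : ∀ a ∈ π.ker, ∀ b ∈ π.ker, a * b = b * a) :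
    ∃ (A : Type) (_ : AddCommGroup A) (ρ : Representation ℤ G A) (ι : A → E),
      IsExtension ρ ι π := by
  let _ : CommGroup π.ker := { mul_comm := fun a b => Subtype.ext (hcomm a a.2 b b.2) }
  choose s hs using hπ
  let c : E →* MulAut π.ker := MulAut.conjNormal
  -- The kernel is abelian, so conjugation on it depends only on the image in `G`.
  have hc : ∀ e e', π e = π e' → c e = c e' := fun e e' h => by
    ext a
    have h1 := hcomm (e'⁻¹ * e) (by
      rw [MonoidHom.mem_ker, map_mul, map_inv, h, inv_mul_cancel]) a a.2
    simp only [c, MulAut.conjNormal_apply]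
    calc e * a * e⁻¹ = e' * (e'⁻¹ * e * a) * e⁻¹ := by group
      _ = e' * a * e'⁻¹ := by rw [h1]; group
  let ρ : Representation ℤ G (Additive π.ker) :=
    { toFun := fun g => (MonoidHom.toAdditive (c (s g)).toMonoidHom).toIntLinearMap
      map_one' := by
        ext a
        have := hc (s 1) 1 (by rw [hs, map_one])
        rw [map_one] at this
        exact congrArg (fun φ : MulAut π.ker => ((φ a.toMul : π.ker) : E)) this
      map_mul' := fun g h => by
        ext a
        have := hc (s (g * h)) (s g * s h) (by rw [map_mul, hs, hs, hs])
        rw [map_mul] at this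
        exact congrArg (fun φ : MulAut π.ker => ((φ a.toMul : π.ker) : E)) this }
  refine ⟨Additive π.ker, inferInstance, ρ, fun a => (a.toMul : E),
    ⟨fun a b => rfl, ?_, fun g => ⟨s g, hs g⟩, ?_, ?_⟩⟩
  · exact fun a b hab => Subtype.ext hab
  · exact fun e => ⟨fun he => ⟨Additive.ofMul ⟨e, he⟩, rfl⟩, fun ⟨a, ha⟩ => ha ▸ a.toMul.2⟩
  · intro e a
    have := hc (s (π e)) e (hs _)
    exact congrArg (fun φ : MulAut π.ker => ((φ a.toMul : π.ker) : E)) this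

/-! ### Comparison of the two Vasquez numbers -/

section

variable {G : Type} [Group G]

theorem hasComplexStructure_realification [Finite G] (hG : Odd (Nat.card G)) {A : Type}
    [AddCommGroup A] [Module.Free ℤ A] [Module.Finite ℤ A] (ρ : Representation ℤ G A)
    (hA : Even (Module.finrank ℤ A)) : HasComplexStructure (realification ρ) :=
  hasComplexStructure_of_even _ hG (by rwa [Module.finrank_baseChange])

/-- If the norm `∑ g, ρ g` is nonzero, composing it with a suitable functional gives an invariant
one. If it is zero, the realification has no invariants, hence a complex structure, and the rank
would be even. -/
theorem exists_invariant_functional [Finite G] (hG : Odd (Nat.card G)) {A : Type}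
    [AddCommGroup A] [Module.Free ℤ A] [Module.Finite ℤ A] (ρ : Representation ℤ G A)
    (hA : Odd (Module.finrank ℤ A)) :
    ∃ φ : A →ₗ[ℤ] ℤ, φ ≠ 0 ∧ ∀ g a, φ (ρ g a) = φ a := by
  cases nonempty_fintype G
  by_contra! hno
  have hP : ∑ g, ρ g = 0 := by
    by_contra hne
    obtain ⟨a, ha⟩ : ∃ a, (∑ g, ρ g) a ≠ 0 := by
      by_contra! h0
      exact hne (LinearMap.ext h0)
    obtain ⟨ψ, hψ⟩ := exists_dual_not_dvd 0 ((∑ g, ρ g) a) (by simpa using ha)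
    obtain ⟨k, b, hkb⟩ := hno (ψ ∘ₗ ∑ g, ρ g) (fun h0 => hψ (by
      have := LinearMap.congr_fun h0 a
      simpa using this))
    apply hkb
    rw [LinearMap.comp_apply, LinearMap.comp_apply, LinearMap.sum_apply, LinearMap.sum_apply]
    congr 1
    exact Fintype.sum_equiv (Equiv.mulRight k) _ _ fun g => by simp
  have hJ : HasComplexStructure (realification ρ) := by
    refine hasComplexStructure_of_no_invariants _ hG fun v hv => ?_
    have h1 : ∑ g, realification ρ g v = (Fintype.card G : ℝ) • v := by
      rw [Finset.sum_congr rfl fun g _ => hv g, Finset.sum_const, Finset.card_univ,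
        Nat.cast_smul_eq_nsmul]
    have h2 : ∑ g, realification ρ g = 0 := by
      change ∑ g, (ρ g).baseChange ℝ = 0
      have := map_sum (LinearMap.baseChangeHom ℤ ℝ A A) ρ Finset.univ
      rw [hP, map_zero] at this
      exact this.symm
    rw [← LinearMap.sum_apply, h2, LinearMap.zero_apply] at h1
    exact (smul_eq_zero.1 h1.symm).resolve_left (by simp)
  obtain ⟨J, hJ, -⟩ := hJ
  have := even_finrank_of_sq_eq_neg J hJ
  rw [Module.finrank_baseChange] at this
  exact Nat.not_even_iff_odd.2 hA this

/-- A pure stable submodule can be shrunk so that the quotient has even rank. -/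
theorem exists_even_quotient [Finite G] (hG : Odd (Nat.card G)) {A : Type}
    [AddCommGroup A] [Module.Free ℤ A] [Module.Finite ℤ A] (ρ : Representation ℤ G A)
    (hA : Even (Module.finrank ℤ A)) (N : Submodule ℤ A) (hN : ∀ g, N ≤ N.comap (ρ g))
    (hpure : IsZPure N) :
    ∃ N' ≤ N, (∀ g, N' ≤ N'.comap (ρ g)) ∧ IsZPure N' ∧ Even (Module.finrank ℤ (A ⧸ N')) ∧
      Module.finrank ℤ (A ⧸ N') ≤ Module.finrank ℤ (A ⧸ N) + 1 := by
  by_cases heven : Even (Module.finrank ℤ (A ⧸ N))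
  · exact ⟨N, le_rfl, hN, hpure, heven, by omega⟩
  have h1 := N.finrank_quotient_add_finrank
  have hodd : Odd (Module.finrank ℤ N) := by
    rw [← h1] at hA
    rw [← Nat.not_even_iff_odd]
    exact fun h => heven ((Nat.even_add.1 hA).2 h)
  -- The kernel of `φ` is stable, pure in `N`, and has rank one less than `N`.
  obtain ⟨φ, hφ0, hφ⟩ := exists_invariant_functional hG (ρ.subrepresentation N hN) hodd
  have hmem : ∀ x, x ∈ (LinearMap.ker φ).map N.subtype ↔ ∃ hx : x ∈ N, φ ⟨x, hx⟩ = 0 := fun x => by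
    simp
  have hrange : Module.finrank ℤ (LinearMap.range φ) = 1 := by
    refine le_antisymm ((Submodule.finrank_le _).trans (by simp)) ?_
    rw [Nat.one_le_iff_ne_zero, Ne, Submodule.finrank_eq_zero, LinearMap.range_eq_bot]
    exact hφ0
  have hker := (LinearMap.ker φ).finrank_quotient_add_finrank
  rw [φ.quotKerEquivRange.finrank_eq] at hker
  have hmap : Module.finrank ℤ ((LinearMap.ker φ).map N.subtype) =
      Module.finrank ℤ (LinearMap.ker φ) :=
    (Submodule.equivMapOfInjective _ N.subtype_injective _).finrank_eq.symm
  have h2 := ((LinearMap.ker φ).map N.subtype).finrank_quotient_add_finrank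
  refine ⟨(LinearMap.ker φ).map N.subtype, Submodule.map_subtype_le _ _, fun g x hx => ?_, ?_,
    ?_, by omega⟩
  · rw [Submodule.mem_comap, hmem]
    obtain ⟨hx, hφx⟩ := (hmem x).1 hx
    exact ⟨hN g hx, (hφ g ⟨x, hx⟩).trans hφx⟩
  · rw [isZPure_iff]
    intro k x hk hx
    obtain ⟨hx, hφx⟩ := (hmem _).1 hx
    have hxN := (isZPure_iff N).1 hpure k x hk hx
    refine (hmem x).2 ⟨hxN, ?_⟩
    have h3 : φ (k • ⟨x, hxN⟩) = 0 := hφx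
    rw [map_nsmul] at h3
    exact Module.Free.nsmul_eq_zero k _ hk h3
  · rw [Nat.not_even_iff_odd] at heven
    rw [show Module.finrank ℤ (A ⧸ (LinearMap.ker φ).map N.subtype) =
      Module.finrank ℤ (A ⧸ N) + 1 by omega]
    exact heven.add_one

/-- The real bound gives a quotient lattice of rank at most `m`. Adjusting it to even rank at most
`m + 1` makes a complex structure available, and the complex dimension is half that rank. -/
theorem IsVasquezBound.isComplexVasquezBound [Finite G] (hG : Odd (Nat.card G)) {m : ℕ}
    (hm : IsVasquezBound G m) : IsComplexVasquezBound G ((m + 1) / 2) := by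
  rintro Γ _ n ⟨F, hfree, hdisc, hspan, hfin⟩ L _ hL ⟨e⟩
  have hF : IsKahlerAction F := ⟨hfree, hdisc, hspan, hfin⟩
  have hLT := hF.eq_translationSubgroup hL
  let π : Γ →* G := e.toMonoidHom.comp (QuotientGroup.mk' L)
  have hπL : π.ker = L := by
    ext γ; simp [π]
  obtain ⟨A, _, ρ, ι, h⟩ := exists_isExtension π
    (e.surjective.comp (QuotientGroup.mk'_surjective L))
    (by rw [hπL]; exact hL.1.2)
  have hιT : ∀ a, ι a ∈ translationSubgroup F := fun a => by
    rw [← hLT, ← hπL, MonoidHom.mem_ker, h.proj]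
  have hTι : ∀ t ∈ translationSubgroup F, ∃ a, ι a = t := fun t ht => by
    rwa [← hLT, ← hπL, MonoidHom.mem_ker, h.exact] at ht
  obtain ⟨τ, hτ, hτF⟩ := hF.exists_toLattice ι h.map_add
    (fun a ha => h.injective (by rw [ha, h.map_zero])) hιT
  have hτs : Function.Surjective τ := fun v => by
    obtain ⟨γ, hγ⟩ := v.2
    obtain ⟨a, rfl⟩ := hTι γ (mem_translationSubgroup_of_apply hγ)
    refine ⟨a, Subtype.ext ?_⟩
    have h1 := hτF a 0
    rw [hγ] at h1
    exact (add_right_cancel h1).symm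
  let T : A ≃ₗ[ℤ] translationVectors F := LinearEquiv.ofBijective τ.toIntLinearMap ⟨hτ, hτs⟩
  have := hF.lattice_free
  have := hF.lattice_finite
  have : Module.Free ℤ A := Module.Free.of_equiv T.symm
  have : Module.Finite ℤ A := Module.Finite.equiv T.symm
  have hrank : Module.finrank ℤ A = 2 * n := by rw [T.finrank_eq, hF.lattice_finrank]
  -- An element acting trivially on `A` commutes with all translations, so it is itself a
  -- translation.
  have hρ : Function.Injective ρ := by
    rw [injective_iff_map_eq_one]
    intro g hg
    obtain ⟨γ, rfl⟩ := h.surjective g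
    rw [← MonoidHom.mem_ker, hπL, hLT]
    refine hF.mem_translationSubgroup_of_commute fun t ht => ?_
    obtain ⟨a, rfl⟩ := hTι t ht
    rw [h.mul_ι, hg, Module.End.one_apply]
  obtain ⟨f, hf⟩ := h.exists_cocycle
  obtain ⟨N, hN, hpure, hNm, hsp⟩ := hm A ρ hρ (groupCohomology.H2π _ f)
    ((isSpecial_iff_torsionFree Module.Free.nsmul_eq_zero h f hf).2 hF.torsionFree)
  obtain ⟨f', hf', hqf⟩ := quotientH2_apply N hN f
  have := h.sub_normal N hN
  obtain ⟨ι₁, π₁, h₁, hfs₁⟩ := h.quotient N hN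
  have hf₁ := hfs₁ _ hf
  rw [show (fun p => N.mkQ (f p)) = f' from (funext hf').symm] at hf₁
  rw [hqf, isSpecial_iff_torsionFree hpure.nsmul_eq_zero h₁ f' hf₁,
    h.torsionFree_quotient_iff] at hsp
  obtain ⟨N', hle, hN', hpure', heven, hN'm⟩ :=
    exists_even_quotient hG ρ (by simp [hrank]) N hN hpure
  have hn := h.sub_normal N' hN'
  obtain ⟨ι₂, π₂, h₂, -⟩ := h.quotient N' hN'
  -- Torsion modulo `N'` is torsion modulo `N`, hence lies in `N`; there purity of `N'` applies.
  have htf : TorsionFree (Γ ⧸ h.sub N') := by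
    rw [h.torsionFree_quotient_iff]
    rintro γ k hk ⟨a, ha, haγ⟩
    obtain ⟨b, hb, rfl⟩ := hsp γ k hk ⟨a, hle ha, haγ⟩
    rw [← h.map_nsmul] at haγ
    rw [h.injective haγ] at ha
    exact ⟨b, (isZPure_iff N').1 hpure' k b hk ha, rfl⟩
  have := hpure'.free_quotient
  refine ⟨h.sub N', hn, ?_, Module.finrank ℤ (A ⧸ N') / 2, by omega,
    h₂.isAsphericalKahlerGroup htf (hasComplexStructure_realification hG _ heven)⟩
  rintro _ ⟨a, -, rfl⟩
  rw [hLT]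
  exact hιT a

/-- The diagonal action on `A × A`. -/
def doubleRep {A : Type} [AddCommGroup A] (ρ : Representation ℤ G A) :
    Representation ℤ G (A × A) where
  toFun g := (ρ g).prodMap (ρ g)
  map_one' := by rw [map_one]; rfl
  map_mul' g h := by rw [map_mul]; rfl

/-- The map `(x, y) ↦ (-y, x)` is already integral and commutes with any diagonal action. -/
theorem hasComplexStructure_doubleRep {A : Type} [AddCommGroup A] (ρ : Representation ℤ G A) :
    HasComplexStructure (realification (doubleRep ρ)) := by
  let J : A × A →ₗ[ℤ] A × A := (-LinearMap.snd ℤ A A).prod (LinearMap.fst ℤ A A)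
  have hJ : J ∘ₗ J = -LinearMap.id := by ext x <;> simp [J]
  refine ⟨J.baseChange ℝ, fun v => ?_, fun g v => ?_⟩
  · rw [← LinearMap.comp_apply, ← LinearMap.baseChange_comp, hJ, LinearMap.baseChange_neg,
      LinearMap.baseChange_id]
    rfl
  · have h1 : J ∘ₗ doubleRep ρ g = doubleRep ρ g ∘ₗ J := by
      ext x <;> simp [J, doubleRep]
    change (J.baseChange ℝ) ((doubleRep ρ g).baseChange ℝ v) =
      (doubleRep ρ g).baseChange ℝ (J.baseChange ℝ v)
    rw [← LinearMap.comp_apply, ← LinearMap.baseChange_comp, h1, LinearMap.baseChange_comp]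
    rfl

/-- An element commuting with the kernel acts trivially on `A`, so by faithfulness it lies in the
kernel. -/
theorem IsExtension.isMaximalAbelianNormal {A E : Type} [AddCommGroup A] [Group E]
    {ρ : Representation ℤ G A} {ι : A → E} {π : E →* G} (h : IsExtension ρ ι π)
    (hρ : Function.Injective ρ) : IsMaximalAbelianNormal π.ker := by
  refine ⟨⟨MonoidHom.normal_ker _, fun a ha b hb => ?_⟩, fun B hB hle b hb => ?_⟩
  · obtain ⟨a, rfl⟩ := (h.exact a).1 ha
    obtain ⟨b, rfl⟩ := (h.exact b).1 hb
    exact h.comm a b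
  · apply hρ
    ext a
    apply h.injective
    rw [h.conj, hB.2 b hb (ι a) (hle (h.proj a)), mul_inv_cancel_right, map_one,
      Module.End.one_apply]

/-- The doubled lattice with the class `(α, 0)` defines a Kähler group with holonomy `G`. If `N₂` is
the submodule divided out by the complex bound and `N` its preimage in the first summand, then `L /
N` embeds equivariantly in `(L × L) / N₂`, which bounds its rank and makes the pushed class special.
-/
theorem IsComplexVasquezBound.isVasquezBound [Finite G] {m : ℕ}
    (hm : IsComplexVasquezBound G m) : IsVasquezBound G (2 * m) := by
  intro L _ _ _ ρ hρ α hα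
  induction α using groupCohomology.H2_induction_on with | h f => ?_
  have hcoc : (fun p => ((f p : L), (0 : L))) ∈
      groupCohomology.cocycles₂ (Rep.of (doubleRep ρ)) := by
    rw [groupCohomology.mem_cocycles₂_iff]
    intro g k j
    have h1 := (groupCohomology.mem_cocycles₂_iff _).1 f.2 g k j
    refine Prod.ext h1 ?_
    change (0 : L) + 0 = ρ g 0 + 0
    simp
  let f' : groupCohomology.cocycles₂ (Rep.of (doubleRep ρ)) := ⟨_, hcoc⟩
  have hsp : IsSpecial (Rep.of (doubleRep ρ)) (groupCohomology.H2π _ f') :=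
    isSpecial_of_map f' f (AddMonoidHom.fst L L) (fun g a => rfl) (fun p => rfl) hα
  obtain ⟨E, _, ι, π, h, hf⟩ := exists_extension f'
  have htf := (isSpecial_iff_torsionFree Module.Free.nsmul_eq_zero h f' hf).1 hsp
  have hinj : Function.Injective (doubleRep ρ) := fun g k hgk => hρ (by
    ext a
    exact congrArg Prod.fst (LinearMap.congr_fun hgk (a, 0)))
  obtain ⟨M, _, hMle, d, hd, hK⟩ := hm E _
    (h.isAsphericalKahlerGroup htf (hasComplexStructure_doubleRep ρ)) π.ker
    (h.isMaximalAbelianNormal hinj) ⟨QuotientGroup.quotientKerEquivOfSurjective π h.surjective⟩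
  obtain ⟨N₂, hN₂, rfl⟩ := h.exists_eq_sub M hMle
  obtain ⟨F, hfree, hdisc, hspan, hfin⟩ := hK
  have hF : IsKahlerAction F := ⟨hfree, hdisc, hspan, hfin⟩
  obtain ⟨ι₂, π₂, h₂, hfs₂⟩ := h.quotient N₂ hN₂
  have htf₂ := (h.torsionFree_quotient_iff N₂).1 hF.torsionFree
  -- The quotient group acts as a Kähler group, so it is torsion-free; restricted to the kernel this
  -- is purity.
  have hpure₂ : IsZPure N₂ := by
    rw [isZPure_iff]
    intro k x hk hx
    rw [← h.ι_mem_sub] at hx ⊢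
    rw [h.map_nsmul] at hx
    exact htf₂ _ k hk hx
  have := hpure₂.free_quotient
  obtain ⟨f₂, hf₂, -⟩ := quotientH2_apply N₂ hN₂ f'
  have hfac := hfs₂ _ hf
  rw [show (fun p => N₂.mkQ (f' p)) = f₂ from (funext hf₂).symm] at hfac
  have hsp₂ := (isSpecial_iff_torsionFree hpure₂.nsmul_eq_zero h₂ f₂ hfac).2 hF.torsionFree
  let N : Submodule ℤ L := N₂.comap (LinearMap.inl ℤ L L)
  have hN : ∀ g, N ≤ N.comap (ρ g) := fun g x hx => by
    have h1 := hN₂ g hx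
    change (ρ g x, ρ g 0) ∈ N₂ at h1
    rw [map_zero] at h1
    exact h1
  let φ : L ⧸ N →ₗ[ℤ] (L × L) ⧸ N₂ := N.mapQ N₂ (LinearMap.inl ℤ L L) le_rfl
  have hφ : Function.Injective φ := by
    rw [injective_iff_map_eq_zero]
    intro x hx
    obtain ⟨a, rfl⟩ := N.mkQ_surjective x
    exact (Submodule.Quotient.mk_eq_zero N).2 ((Submodule.Quotient.mk_eq_zero N₂).1 hx)
  refine ⟨N, hN, ?_, ?_, ?_⟩
  · rw [isZPure_iff]
    intro k x hk hx
    refine (isZPure_iff N₂).1 hpure₂ k _ hk ?_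
    rw [← map_nsmul]
    exact hx
  · exact (LinearMap.finrank_le_finrank_of_injective hφ).trans
      ((hF.finrank_le h₂).trans (by omega))
  · obtain ⟨f₁, hf₁, hqf⟩ := quotientH2_apply N hN f
    rw [hqf]
    refine isSpecial_of_map f₁ f₂ φ.toAddMonoidHom (fun g x => ?_) (fun p => ?_) hsp₂
    · obtain ⟨a, rfl⟩ := N.mkQ_surjective x
      change N₂.mkQ (ρ g a, 0) = N₂.mkQ (ρ g a, ρ g 0)
      rw [map_zero]
    · rw [hf₁, hf₂]
      rfl

end

theorem mainTheorem6 (G : Type) [Group G] [Finite G] (hG : Odd (Nat.card G)) :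
    {m | IsVasquezBound G m}.Nonempty ∧ {m | IsComplexVasquezBound G m}.Nonempty ∧
      complexVasquezNumber G = (vasquezNumber G + 1) / 2 := by
  have hV : {m | IsVasquezBound G m}.Nonempty := ⟨_, exists_isVasquezBound G⟩
  have hn : IsVasquezBound G (vasquezNumber G) := Nat.sInf_mem hV
  have hle := hn.isComplexVasquezBound hG
  have hC : {m | IsComplexVasquezBound G m}.Nonempty := ⟨_, hle⟩
  have hm : IsComplexVasquezBound G (complexVasquezNumber G) := Nat.sInf_mem hC
  have h1 : complexVasquezNumber G ≤ (vasquezNumber G + 1) / 2 := Nat.sInf_le hle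
  have h2 : vasquezNumber G ≤ 2 * complexVasquezNumber G := Nat.sInf_le hm.isVasquezBound
  -- The bound `n ≤ 2 * c` gives `c ≥ ⌈n / 2⌉ = ⌊(n + 1) / 2⌋`, so both inequalities are sharp.
  exact ⟨hV, hC, by omega⟩
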